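/- Let $n\ge 0$ be an integer and let $d\nu(w)=(2\pi)^{-n}e^{-\frac12|w|^2}\,dw$ on $\mathbb C^n$. The Fock space $\mathcal F(\mathbb C^n)$ is the space of entire functions on $\mathbb C^n$ that are square integrable with respect to $\nu$, with the norm of $L^2(\nu)$. For $z,w\in\mathbb C^n$ write $z\cdot w=\sum_j z_jw_j$ and $z^2=z\cdot z$. For $\varphi\in\mathcal F(\mathbb C^n)$ put $$S_\varphi F(z)=\int_{\mathbb C^n}F(w)\,\varphi(z-\bar w)\,e^{\frac12 z\cdot\bar w}\,d\nu(w),\qquad \widetilde S_\varphi F(z)=\int_{\mathbb C^n}F(w)\,\varphi(z+\bar w)\,e^{\frac12 z\cdot\bar w}\,d\nu(w).$$ The domain of each of these operators consists of all $F\in\mathcal F(\mathbb C^n)$ for which the integral converges absolutely for every $z\in\mathbb C^n$. The operator is called bounded if it maps its domain into $\mathcal F(\mathbb C^n)$ and, for some constant $C$, increases norms at most by the factor $C$ there; otherwise it is called unbounded. **Theorem 1.1.** Let $\varphi\in\mathcal F(\mathbb C^n)$. 1. $S_\varphi$ is bounded if and only if there is $m\in L^\infty(\mathbb R^n)$ such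 that $\varphi(z)=\int_{\mathbb R^n}m(\xi)\,e^{-(\xi-\frac i2z)^2}\,d\xi$ for all $z\in\mathbb C^n$. 2. $\widetilde S_\varphi$ is bounded if and only if there is $m\in L^\infty(\mathbb R^n)$ such that $\varphi(z)=\int_{\mathbb R^n}m(\xi)\,e^{-(\xi-\frac12z)^2}\,d\xi$ for all $z\in\mathbb C^n$. 3. If $S_\varphi$ (respectively $\widetilde S_\varphi$) is bounded, then its domain is all of $\mathcal F(\mathbb C^n)$. 4. If $\varphi$ is not constant, then at least one of $S_\varphi$, $\widetilde S_\varphi$ is unbounded. -/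

import Mathlib

open MeasureTheory
open scoped ENNReal NNReal ComplexConjugate

noncomputable section

/-- The normalised Gaussian measure `dν(w) = (2π)⁻ⁿ exp(-|w|²/2) dw` on `ℂⁿ`, where `dw` is
Lebesgue measure and `|w|² = ∑ j, |w j|²`. -/
def fockMeasure (n : ℕ) : Measure (Fin n → ℂ) :=
  (volume : Measure (Fin n → ℂ)).withDensity fun w =>
    ENNReal.ofReal (((2 * Real.pi) ^ n)⁻¹ * Real.exp (-(1 / 2) * ∑ j, ‖w j‖ ^ 2))

/-- The Fock space on `ℂⁿ`: entire functions that are square integrable with respect to `ν`. -/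
def FockSpace (n : ℕ) : Submodule ℂ ((Fin n → ℂ) → ℂ) where
  carrier := {F | Differentiable ℂ F ∧ MemLp F 2 (fockMeasure n)}
  add_mem' hF hG := ⟨hF.1.add hG.1, hF.2.add hG.2⟩
  zero_mem' := ⟨differentiable_const 0, MemLp.zero⟩
  smul_mem' c _ hF := ⟨hF.1.const_smul c, hF.2.const_smul c⟩

/-- The bilinear (not Hermitian) product `z · w = ∑ j, z j * w j` on `ℂⁿ`. -/
def bilin {n : ℕ} (z w : Fin n → ℂ) : ℂ := ∑ j, z j * w j

/-- The coordinatewise complex conjugate of a vector of `ℂⁿ`. -/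
def conjVec {n : ℕ} (w : Fin n → ℂ) : Fin n → ℂ := fun j => conj (w j)

/-- The kernel `φ(z - w̄) exp(z · w̄ / 2)` of the operator `S_φ`. -/
def kernelS {n : ℕ} (φ : (Fin n → ℂ) → ℂ) (z w : Fin n → ℂ) : ℂ :=
  φ (z - conjVec w) * Complex.exp (1 / 2 * bilin z (conjVec w))

/-- The kernel `φ(z + w̄) exp(z · w̄ / 2)` of the operator `S̃_φ`. -/
def kernelSTilde {n : ℕ} (φ : (Fin n → ℂ) → ℂ) (z w : Fin n → ℂ) : ℂ :=
  φ (z + conjVec w) * Complex.exp (1 / 2 * bilin z (conjVec w))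

/-- The integral operator with kernel `K`: `F ↦ (z ↦ ∫ F(w) K(z,w) dν(w))`. -/
def fockIntegralOp {n : ℕ} (K : (Fin n → ℂ) → (Fin n → ℂ) → ℂ) (F : (Fin n → ℂ) → ℂ) :
    (Fin n → ℂ) → ℂ :=
  fun z => ∫ w, F w * K z w ∂(fockMeasure n)

/-- The natural domain, inside the Fock space, of the integral operator with kernel `K`: those `F`
for which the integral defining the operator converges absolutely at every point. For the kernels
above with `φ` in the Fock space it contains all polynomials and all functions
`w ↦ exp(w · a / 2)`, so that it is dense. -/
def fockOpDomain {n : ℕ} (K : (Fin n → ℂ) → (Fin n → ℂ) → ℂ) : Set ((Fin n → ℂ) → ℂ) :=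
  {F | F ∈ FockSpace n ∧ ∀ z, Integrable (fun w => F w * K z w) (fockMeasure n)}

/-- The integral operator with kernel `K` is bounded on the Fock space: it maps its natural domain
into the Fock space, with a norm bound. -/
def IsBoundedOnFock {n : ℕ} (K : (Fin n → ℂ) → (Fin n → ℂ) → ℂ) : Prop :=
  ∃ C : ℝ≥0, ∀ F ∈ fockOpDomain K,
    fockIntegralOp K F ∈ FockSpace n ∧
      eLpNorm (fockIntegralOp K F) 2 (fockMeasure n) ≤ C * eLpNorm F 2 (fockMeasure n)

/-- The square `(ξ - c z)² = ∑ j, (ξ j - c z j)²` for `ξ ∈ ℝⁿ`, `z ∈ ℂⁿ`, `c ∈ ℂ`. -/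
def shiftSq {n : ℕ} (c : ℂ) (ξ : Fin n → ℝ) (z : Fin n → ℂ) : ℂ := ∑ j, ((ξ j : ℂ) - c * z j) ^ 2

end

/-! The Bargmann transform B = `bargmann` carries L²(ℝⁿ) isometrically onto the Fock space and turns
multiplication operators into the operators S_φ. Write k_z for `bargmannKernel z` and φ = Bh
(`exists_bargmann_eq`). By the reproducing property, S_φ sends exp(-a·w/2) = B k_a to φ(z+a)
exp(-z·a/2) (`fockIntegralOp_fockExp`), and k_0 k_{z+a} = k_z k_a exp(z·a/2) (`bargmannKernel_add`)
rewrites this as B((h/k_0) k_a). The k_a with a real span a dense subspace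
(`span_bargmannLp_dense`), so a bound for S_φ makes h/k_0 a bounded multiplier of L², hence an
essentially bounded function. Since k_0 k_z is π^(-n/2) times the Gaussian of the theorem, m =
π^(-n/2) h/k_0 is the required symbol. Conversely, for bounded m the kernel of S_φ at each z is a
multiple of the conjugate of the Bargmann transform of an L² function; Cauchy–Schwarz makes the
domain the whole space, and S_φ F = B(π^(n/2) m B*F).

The rotation w ↦ iw conjugates S̃_φ to the operator S of φ(i·) (`kernelS_comp_I`), which settles
S̃_φ.

If both operators are bounded, the Gaussian averages give |φ| ≤ C exp(|Re z|²/4) and |φ| ≤ C exp(|Im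
z|²/4) (`norm_le_of_symbol`). On a complex line through 0 and a real vector, Phragmén–Lindelöf in
each quadrant (`norm_le_of_quadrant`) and Liouville make φ constant; the identity theorem passes
from ℝⁿ to ℂⁿ. -/

noncomputable section

/-! ### The Gaussian measure and the reproducing property -/

/-- The density of `fockMeasure` with respect to Lebesgue measure. -/
def fockDensity {n : ℕ} (w : Fin n → ℂ) : ℝ :=
  ((2 * Real.pi) ^ n)⁻¹ * Real.exp (-(1 / 2) * ∑ j, ‖w j‖ ^ 2)

lemma fockDensity_pos {n : ℕ} (w : Fin n → ℂ) : 0 < fockDensity w := by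
  unfold fockDensity; positivity

lemma continuous_fockDensity {n : ℕ} : Continuous (fockDensity (n := n)) := by
  unfold fockDensity; fun_prop

lemma fockMeasure_eq (n : ℕ) :
    fockMeasure n = volume.withDensity fun w => ENNReal.ofReal (fockDensity w) := rfl

lemma measurable_ofReal_fockDensity {n : ℕ} :
    Measurable fun w : Fin n → ℂ => ENNReal.ofReal (fockDensity w) :=
  continuous_fockDensity.measurable.ennreal_ofReal

lemma integral_fockMeasure {n : ℕ} (F : (Fin n → ℂ) → ℂ) :
    ∫ w, F w ∂fockMeasure n = ∫ w, fockDensity w • F w := by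
  rw [fockMeasure_eq, integral_withDensity_eq_integral_toReal_smul measurable_ofReal_fockDensity
    (by simp)]
  simp [ENNReal.toReal_ofReal (fockDensity_pos _).le]

lemma integrable_fockMeasure_iff {n : ℕ} {E : Type*} [NormedAddCommGroup E] [NormedSpace ℝ E]
    (F : (Fin n → ℂ) → E) :
    Integrable F (fockMeasure n) ↔ Integrable fun w => fockDensity w • F w := by
  rw [fockMeasure_eq, integrable_withDensity_iff_integrable_smul' measurable_ofReal_fockDensity
    (by simp)]
  simp [ENNReal.toReal_ofReal (fockDensity_pos _).le]

/-- The density depends only on the moduli of the coordinates. This serves for conjugation,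
reflection and rotations alike. -/
lemma measurePreserving_fockMeasure {n : ℕ} (e : ℂ ≃ₗᵢ[ℝ] ℂ) :
    MeasurePreserving (fun (w : Fin n → ℂ) j => e (w j)) (fockMeasure n) (fockMeasure n) := by
  have hv : MeasurePreserving (fun (w : Fin n → ℂ) j => e (w j)) volume volume :=
    volume_preserving_pi fun _ => e.measurePreserving
  refine ⟨hv.measurable, ?_⟩
  ext s hs
  rw [Measure.map_apply hv.measurable hs, fockMeasure_eq,
    withDensity_apply _ (hv.measurable hs), withDensity_apply _ hs,
    ← hv.setLIntegral_comp_preimage hs measurable_ofReal_fockDensity]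
  simp [fockDensity]

lemma measurableEmbedding_isometry {n : ℕ} (e : ℂ ≃ₗᵢ[ℝ] ℂ) :
    MeasurableEmbedding (fun (w : Fin n → ℂ) j => e (w j)) :=
  (MeasurableEquiv.piCongrRight
    fun _ : Fin n => e.toHomeomorph.toMeasurableEquiv).measurableEmbedding

lemma integral_fockMeasure_comp {n : ℕ} (e : ℂ ≃ₗᵢ[ℝ] ℂ) (F : (Fin n → ℂ) → ℂ) :
    ∫ w, F (fun j => e (w j)) ∂fockMeasure n = ∫ w, F w ∂fockMeasure n :=
  (measurePreserving_fockMeasure e).integral_comp (measurableEmbedding_isometry e) F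

lemma integrable_fockMeasure_comp {n : ℕ} (e : ℂ ≃ₗᵢ[ℝ] ℂ) {E : Type*} [NormedAddCommGroup E]
    (F : (Fin n → ℂ) → E) :
    Integrable (fun w => F (fun j => e (w j))) (fockMeasure n) ↔ Integrable F (fockMeasure n) :=
  (measurePreserving_fockMeasure e).integrable_comp_emb (measurableEmbedding_isometry e)

lemma integrable_prod_gaussian {n : ℕ} {b : ℝ} (hb : 0 < b) :
    Integrable fun w : Fin n → ℂ => Real.exp (-b * ∑ j, ‖w j‖ ^ 2) := by
  have h1 : Integrable fun w : ℂ => Real.exp (-b * ‖w‖ ^ 2) := by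
    have := (GaussianFourier.integrable_cexp_neg_mul_sq_norm_add (V := ℂ) (b := b)
      (by simpa using hb) 0 0).norm
    refine this.congr (.of_forall fun w => ?_)
    simp only [Complex.norm_exp]
    norm_num [← Complex.ofReal_pow]
  have := Integrable.fintype_prod (𝕜 := ℝ) (ι := Fin n) (f := fun _ (w : ℂ) => Real.exp (-b * ‖w‖ ^ 2))
    (μ := fun _ => volume) (fun _ => h1)
  refine this.congr (.of_forall fun w => ?_)
  simp [← Real.exp_sum, Finset.mul_sum]

lemma integral_prod_gaussian {n : ℕ} {b : ℝ} (hb : 0 < b) :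
    ∫ w : Fin n → ℂ, Real.exp (-b * ∑ j, ‖w j‖ ^ 2) = (Real.pi / b) ^ n := by
  have h1 : ∫ w : ℂ, Real.exp (-b * ‖w‖ ^ 2) = Real.pi / b := by
    have := GaussianFourier.integral_rexp_neg_mul_sq_norm (V := ℂ) hb
    simpa using this
  have := integral_fintype_prod_volume_eq_pow (ι := Fin n) (fun w : ℂ => Real.exp (-b * ‖w‖ ^ 2))
  rw [h1, Fintype.card_fin] at this
  rw [← this]
  simp [← Real.exp_sum, Finset.mul_sum]

instance isProbabilityMeasure_fockMeasure (n : ℕ) : IsProbabilityMeasure (fockMeasure n) := by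
  constructor
  rw [fockMeasure_eq, withDensity_apply _ MeasurableSet.univ, Measure.restrict_univ,
    ← ofReal_integral_eq_lintegral_ofReal
      (by exact (integrable_prod_gaussian (by norm_num)).const_mul _)
      (.of_forall fun w => (fockDensity_pos w).le)]
  unfold fockDensity
  rw [integral_const_mul, integral_prod_gaussian (by norm_num), ENNReal.ofReal_eq_one]
  have : (2 * Real.pi) ^ n ≠ 0 := by positivity
  rw [show Real.pi / (1 / 2) = 2 * Real.pi by ring]
  exact inv_mul_cancel₀ this

lemma integrable_exp_sum_norm {n : ℕ} (R : ℝ) :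
    Integrable (fun w : Fin n → ℂ => Real.exp (R * ∑ j, ‖w j‖)) (fockMeasure n) := by
  rw [integrable_fockMeasure_iff]
  refine Integrable.mono' (((integrable_prod_gaussian (n := n) (b := 1 / 4)
    (by norm_num)).const_mul (((2 * Real.pi) ^ n)⁻¹ * Real.exp (n * R ^ 2)))) ?_
    (.of_forall fun w => ?_)
  · exact (continuous_fockDensity.smul (by fun_prop)).aestronglyMeasurable
  · rw [norm_smul, Real.norm_of_nonneg (fockDensity_pos w).le, Real.norm_of_nonneg (by positivity),
      fockDensity, mul_assoc, mul_assoc, ← Real.exp_add, ← Real.exp_add]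
    refine mul_le_mul_of_nonneg_left (Real.exp_le_exp.2 ?_) (by positivity)
    -- R t ≤ R² + t²/4 leaves half of the Gaussian exponent t²/2 for integrability.
    have h : ∑ j, (R * ‖w j‖) ≤ ∑ j : Fin n, (R ^ 2 + 1 / 4 * ‖w j‖ ^ 2) :=
      Finset.sum_le_sum fun j _ => by nlinarith [sq_nonneg (R - ‖w j‖ / 2)]
    rw [Finset.sum_add_distrib, ← Finset.mul_sum, ← Finset.mul_sum] at h
    simp only [Finset.sum_const, Finset.card_univ, Fintype.card_fin, nsmul_eq_mul] at h
    linarith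

lemma memLp_exp_sum_norm {n : ℕ} (R : ℝ) :
    MemLp (fun w : Fin n → ℂ => Real.exp (R * ∑ j, ‖w j‖)) 2 (fockMeasure n) := by
  rw [memLp_two_iff_integrable_sq (Continuous.aestronglyMeasurable (by fun_prop))]
  refine (integrable_exp_sum_norm (2 * R)).congr (.of_forall fun w => ?_)
  simp only [← Real.exp_nat_mul]
  ring_nf

lemma abs_re_bilin_le {n : ℕ} (a w : Fin n → ℂ) : |(bilin a w).re| ≤ ‖a‖ * ∑ j, ‖w j‖ := by
  refine (Complex.abs_re_le_norm _).trans ((norm_sum_le _ _).trans ?_)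
  rw [Finset.mul_sum]
  gcongr with j
  rw [norm_mul]
  gcongr
  exact norm_le_pi_norm a j

lemma memLp_of_norm_le_exp {n : ℕ} {F : (Fin n → ℂ) → ℂ} (hF : Continuous F) (C R : ℝ)
    (h : ∀ w, ‖F w‖ ≤ C * Real.exp (R * ∑ j, ‖w j‖)) : MemLp F 2 (fockMeasure n) :=
  ((memLp_exp_sum_norm R).const_mul C).mono' hF.aestronglyMeasurable (.of_forall h)

lemma differentiable_bilin {n : ℕ} (a : Fin n → ℂ) : Differentiable ℂ fun w => bilin a w := by
  unfold bilin; fun_prop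

/-- The Cameron–Martin factor for the shift by `b`, from expanding |b + u|². -/
lemma fockDensity_add {n : ℕ} (b u : Fin n → ℂ) :
    fockDensity (b + u) =
      Real.exp (-(1 / 2) * ∑ j, ‖b j‖ ^ 2 - (bilin (conjVec b) u).re) * fockDensity u := by
  unfold fockDensity
  rw [mul_left_comm, ← Real.exp_add]
  congr 2
  simp only [bilin, conjVec, Complex.re_sum, Finset.mul_sum, ← Finset.sum_add_distrib,
    ← Finset.sum_sub_distrib]
  refine Finset.sum_congr rfl fun j _ => ?_
  simp only [Complex.sq_norm, Complex.normSq_apply, Pi.add_apply, Complex.add_re, Complex.add_im,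
    Complex.mul_re, Complex.conj_re, Complex.conj_im]
  ring

lemma integral_fockMeasure_translate {n : ℕ} (b : Fin n → ℂ) (F : (Fin n → ℂ) → ℂ) :
    ∫ w, F w ∂fockMeasure n =
      ∫ u, Real.exp (-(1 / 2) * ∑ j, ‖b j‖ ^ 2 - (bilin (conjVec b) u).re) • F (b + u)
        ∂fockMeasure n := by
  rw [integral_fockMeasure, integral_fockMeasure,
    ← integral_add_left_eq_self (fun w => fockDensity w • F w) b]
  simp only [fockDensity_add, smul_smul, mul_comm]

lemma integrable_fockMeasure_translate {n : ℕ} (b : Fin n → ℂ) (F : (Fin n → ℂ) → ℂ) :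
    Integrable F (fockMeasure n) ↔ Integrable (fun u =>
      Real.exp (-(1 / 2) * ∑ j, ‖b j‖ ^ 2 - (bilin (conjVec b) u).re) • F (b + u)) (fockMeasure n) := by
  rw [integrable_fockMeasure_iff, integrable_fockMeasure_iff,
    ← (measurePreserving_add_left volume b).integrable_comp_emb
      (measurableEmbedding_addLeft b)]
  simp only [Function.comp_def, fockDensity_add, smul_smul, mul_comm]

/-- The mean value property of entire functions with respect to `fockMeasure`. -/
lemma integral_fockMeasure_eq_apply_zero {n : ℕ} {H : (Fin n → ℂ) → ℂ} (hd : Differentiable ℂ H)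
    (hi : Integrable H (fockMeasure n)) : ∫ w, H w ∂fockMeasure n = H 0 := by
  -- The measure is invariant under w ↦ exp(iθ)w, so `H` may be averaged over θ first; on each
  -- complex line through 0 that average is H(0).
  have hrot : ∀ θ : ℝ, ∀ w : Fin n → ℂ,
      (fun j => rotation (Circle.exp θ) (w j)) = circleMap 0 1 θ • w := by
    intro θ w; ext j; simp [rotation_apply, circleMap]
  have hint : ∀ θ : ℝ, ∫ w, H (circleMap 0 1 θ • w) ∂fockMeasure n = ∫ w, H w ∂fockMeasure n :=
    fun θ => by simpa only [hrot] using integral_fockMeasure_comp (rotation (Circle.exp θ)) H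
  have hnorm : ∀ θ : ℝ, ∫ w, ‖H (circleMap 0 1 θ • w)‖ ∂fockMeasure n
      = ∫ w, ‖H w‖ ∂fockMeasure n := fun θ => by
    simpa only [hrot] using (measurePreserving_fockMeasure (rotation (Circle.exp θ))).integral_comp
      (measurableEmbedding_isometry _) fun w => ‖H w‖
  have hmean : ∀ w : Fin n → ℂ, ∫ θ in (0 : ℝ)..2 * Real.pi, H (circleMap 0 1 θ • w)
      = (2 * Real.pi : ℝ) • H 0 := by
    intro w
    have hdw : Differentiable ℂ fun l : ℂ => H (l • w) :=
      hd.comp (differentiable_id.smul_const w)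
    have := (hdw.diffContOnCl (s := Metric.ball 0 |1|)).circleAverage
    rw [Real.circleAverage_def, zero_smul] at this
    rw [← this, smul_smul, mul_inv_cancel₀ (by positivity), one_smul]
  have hprod : Integrable (Function.uncurry fun (θ : ℝ) w => H (circleMap 0 1 θ • w))
      ((volume.restrict (Set.uIoc 0 (2 * Real.pi))).prod (fockMeasure n)) := by
    rw [integrable_prod_iff]
    · refine ⟨.of_forall fun θ => ?_, ?_⟩
      · simpa only [hrot, Function.uncurry_apply_pair] using
          (integrable_fockMeasure_comp (rotation (Circle.exp θ)) H).2 hi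
      · change Integrable (fun θ => ∫ w, ‖H (circleMap 0 1 θ • w)‖ ∂fockMeasure n) _
        simp only [hnorm]
        exact integrableOn_const (by simp [Set.uIoc])
    · refine Continuous.aestronglyMeasurable ?_
      have := hd.continuous
      unfold Function.uncurry
      fun_prop
  have hswap := intervalIntegral_integral_swap hprod
  simp only [hint, hmean] at hswap
  simp only [intervalIntegral.integral_const, integral_const, sub_zero, probReal_univ,
    one_smul] at hswap
  exact smul_right_injective ℂ (by positivity : (2 * Real.pi : ℝ) ≠ 0) hswap

/-- The reproducing property of the kernel `exp(b · w̄ / 2)`. -/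
lemma integral_mul_exp_conj {n : ℕ} {G : (Fin n → ℂ) → ℂ} (hd : Differentiable ℂ G)
    (b : Fin n → ℂ)
    (hi : Integrable (fun w => G w * Complex.exp (1 / 2 * bilin b (conjVec w))) (fockMeasure n)) :
    ∫ w, G w * Complex.exp (1 / 2 * bilin b (conjVec w)) ∂fockMeasure n = G b := by
  -- After the shift by `b`, the antiholomorphic part of the Cameron–Martin factor cancels the
  -- kernel. A holomorphic integrand remains, and the mean value property applies.
  have key : ∀ u : Fin n → ℂ,
      Real.exp (-(1 / 2) * ∑ j, ‖b j‖ ^ 2 - (bilin (conjVec b) u).re) •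
        (G (b + u) * Complex.exp (1 / 2 * bilin b (conjVec (b + u))))
      = G (b + u) * Complex.exp (-(1 / 2) * bilin (conjVec b) u) := by
    intro u
    rw [Complex.real_smul, mul_left_comm, Complex.ofReal_exp, ← Complex.exp_add]
    congr 2
    rw [Complex.ofReal_sub, Complex.re_eq_add_conj]
    simp only [bilin, conjVec, map_sum, Finset.mul_sum, ← Finset.sum_add_distrib, Finset.sum_div,
      Complex.ofReal_sum, ← Finset.sum_sub_distrib, Complex.ofReal_mul, Complex.ofReal_pow,
      ← Complex.mul_conj']
    refine Finset.sum_congr rfl fun j _ => ?_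
    simp
    ring
  rw [integral_fockMeasure_translate b]
  rw [integrable_fockMeasure_translate b] at hi
  simp only [key] at hi ⊢
  rw [integral_fockMeasure_eq_apply_zero _ hi]
  · simp [bilin]
  · exact (hd.comp (by fun_prop)).mul ((differentiable_bilin _).const_mul _).cexp

/-! ### The Bargmann kernel and its transform -/

/-- The kernel of the Bargmann transform, normalised so that the transform is an isometry from
`L²(ℝⁿ)` to the Fock space. -/
def bargmannKernel {n : ℕ} (z : Fin n → ℂ) (ξ : Fin n → ℝ) : ℂ :=
  (Real.pi ^ (-(n : ℝ) / 4) : ℝ) *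
    Complex.exp (∑ j, (-(ξ j : ℂ) ^ 2 / 2 + Complex.I * z j * ξ j + z j ^ 2 / 4))

lemma continuous_bargmannKernel {n : ℕ} (z : Fin n → ℂ) : Continuous (bargmannKernel z) := by
  unfold bargmannKernel; fun_prop

lemma bargmannKernel_ne_zero {n : ℕ} (z : Fin n → ℂ) (ξ : Fin n → ℝ) :
    bargmannKernel z ξ ≠ 0 := by
  have : Real.pi ^ (-(n : ℝ) / 4) ≠ 0 := by positivity
  exact mul_ne_zero (by exact_mod_cast this) (Complex.exp_ne_zero _)

/-- This turns Hermitian inner products of kernels into the bilinear Gaussian integrals computed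
below. -/
lemma conj_bargmannKernel {n : ℕ} (z : Fin n → ℂ) (ξ : Fin n → ℝ) :
    conj (bargmannKernel z ξ) = bargmannKernel (-conjVec z) ξ := by
  simp only [bargmannKernel, map_mul, Complex.conj_ofReal, ← Complex.exp_conj, map_sum, map_add,
    map_div₀, map_neg, map_pow, Complex.conj_I, conjVec, Pi.neg_apply, map_ofNat]
  congr 2
  refine Finset.sum_congr rfl fun j _ => ?_
  ring

lemma bargmannKernel_mul {n : ℕ} (a b : Fin n → ℂ) (ξ : Fin n → ℝ) :
    bargmannKernel a ξ * bargmannKernel b ξ = (Real.pi ^ (-(n : ℝ) / 2) : ℝ) *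
      Complex.exp (∑ j, (-(ξ j : ℂ) ^ 2 + Complex.I * (a j + b j) * ξ j
        + (a j ^ 2 + b j ^ 2) / 4)) := by
  have h : Real.pi ^ (-(n : ℝ) / 2) = Real.pi ^ (-(n : ℝ) / 4) * Real.pi ^ (-(n : ℝ) / 4) := by
    rw [← Real.rpow_add Real.pi_pos]
    ring_nf
  rw [bargmannKernel, bargmannKernel, mul_mul_mul_comm, ← Complex.exp_add,
    ← Finset.sum_add_distrib, h, Complex.ofReal_mul]
  congr 2
  refine Finset.sum_congr rfl fun j _ => ?_
  ring

/-- Completing the square. This is the link between the Gaussian of the theorem and the Bargmann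
kernel, and the origin of the constants π^(±n/2). -/
lemma bargmannKernel_zero_mul {n : ℕ} (z : Fin n → ℂ) (ξ : Fin n → ℝ) :
    bargmannKernel 0 ξ * bargmannKernel z ξ =
      (Real.pi ^ (-(n : ℝ) / 2) : ℝ) * Complex.exp (-shiftSq (Complex.I / 2) ξ z) := by
  rw [bargmannKernel_mul, shiftSq, ← Finset.sum_neg_distrib]
  congr 2
  refine Finset.sum_congr rfl fun j _ => ?_
  simp only [Pi.zero_apply]
  linear_combination ((z j) ^ 2 / 4) * Complex.I_sq

/-- The Gaussian integral contributes -(a+b)²/4 to the exponent; with (a²+b²)/4 already there, only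
the cross term survives. -/
lemma integral_bargmannKernel_mul {n : ℕ} (a b : Fin n → ℂ) :
    ∫ ξ, bargmannKernel a ξ * bargmannKernel b ξ = Complex.exp (-(1 / 2) * bilin a b) := by
  have h : ∀ ξ : Fin n → ℝ, bargmannKernel a ξ * bargmannKernel b ξ =
      ((Real.pi ^ (-(n : ℝ) / 2) : ℝ) * Complex.exp (∑ j, (a j ^ 2 + b j ^ 2) / 4)) *
      Complex.exp (-1 * ∑ j, (ξ j : ℂ) ^ 2 + ∑ j, (Complex.I * (a j + b j)) * ξ j) := by
    intro ξ
    rw [bargmannKernel_mul, mul_assoc, ← Complex.exp_add]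
    simp only [Finset.sum_add_distrib, Finset.sum_neg_distrib]
    congr 2
    ring
  simp only [h]
  rw [integral_const_mul, GaussianFourier.integral_cexp_neg_mul_sum_add (by norm_num)]
  have hpi : ((Real.pi ^ (-(n : ℝ) / 2) : ℝ) : ℂ) * (Real.pi / 1 : ℂ) ^ (Fintype.card (Fin n) / 2 : ℂ)
      = 1 := by
    rw [div_one, Complex.ofReal_cpow Real.pi_pos.le, ← Complex.cpow_add _ _ (by simp),
      Fintype.card_fin]
    push_cast
    rw [neg_div, neg_add_cancel, Complex.cpow_zero]
  rw [mul_mul_mul_comm, hpi, one_mul, ← Complex.exp_add]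
  congr 1
  rw [Finset.sum_div, ← Finset.sum_add_distrib, bilin, Finset.mul_sum]
  refine Finset.sum_congr rfl fun j _ => ?_
  linear_combination ((a j + b j) ^ 2 / 4) * Complex.I_sq

/-- A bound locally uniform in `z`, for differentiating under the integral; the factor exp(∑|ξ_j|)
leaves room for the linear factor that the derivative produces. -/
lemma norm_bargmannKernel_mul_exp_le {n : ℕ} {z : Fin n → ℂ} {R : ℝ} (hz : ‖z‖ ≤ R)
    (ξ : Fin n → ℝ) :
    ‖bargmannKernel z ξ‖ * Real.exp (∑ j, |ξ j|) ≤
      Real.pi ^ (-(n : ℝ) / 4) * Real.exp (n * ((R + 1) ^ 2 + R ^ 2 / 4)) *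
        Real.exp (-(1 / 4) * ∑ j, ξ j ^ 2) := by
  have hR : 0 ≤ R := (norm_nonneg z).trans hz
  rw [bargmannKernel, norm_mul, Complex.norm_real, Real.norm_of_nonneg (by positivity),
    Complex.norm_exp, mul_assoc, mul_assoc, ← Real.exp_add, ← Real.exp_add]
  refine mul_le_mul_of_nonneg_left (Real.exp_le_exp.2 ?_) (by positivity)
  -- Coordinatewise, (R+1)|ξ| ≤ (R+1)² + ξ²/4; R bounds the imaginary shift and the 1 comes from the
  -- extra exponential.
  have h : ∑ j, ((-(ξ j : ℂ) ^ 2 / 2 + Complex.I * z j * ξ j + z j ^ 2 / 4).re + |ξ j|)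
      ≤ ∑ j, (((R + 1) ^ 2 + R ^ 2 / 4) + -(1 / 4) * ξ j ^ 2) := by
    refine Finset.sum_le_sum fun j _ => ?_
    have h1 : (-(ξ j : ℂ) ^ 2 / 2 + Complex.I * z j * ξ j + z j ^ 2 / 4).re =
        - ξ j ^ 2 / 2 - (z j).im * ξ j + ((z j).re ^ 2 - (z j).im ^ 2) / 4 := by
      simp [pow_two]
      ring
    have h2 : ‖z j‖ ≤ R := (norm_le_pi_norm z j).trans hz
    have h3 : |(z j).im| ≤ R := (Complex.abs_im_le_norm _).trans h2
    have h4 : |(z j).re| ≤ R := (Complex.abs_re_le_norm _).trans h2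
    have h5 : -((z j).im * ξ j) ≤ R * |ξ j| := by
      refine (neg_le_abs _).trans ?_
      rw [abs_mul]
      gcongr
    have h6 : (z j).re ^ 2 ≤ R ^ 2 := by
      rw [← sq_abs]; gcongr
    rw [h1]
    nlinarith [sq_nonneg (R + 1 - |ξ j| / 2), sq_abs (ξ j), sq_nonneg (z j).im]
  rw [Finset.sum_add_distrib, Finset.sum_add_distrib, ← Finset.mul_sum] at h
  simpa [← mul_add] using h

lemma integrable_exp_neg_sum_sq {n : ℕ} {b : ℝ} (hb : 0 < b) :
    Integrable fun ξ : Fin n → ℝ => Real.exp (-b * ∑ j, ξ j ^ 2) := by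
  have := (GaussianFourier.integrable_cexp_neg_mul_sum_add (ι := Fin n) (b := b)
      (by simpa using hb) 0).norm
  refine this.congr (.of_forall fun w => ?_)
  simp only [Complex.norm_exp]
  norm_num [← Complex.ofReal_pow, ← Complex.ofReal_sum]

lemma memLp_exp_neg_sum_sq {n : ℕ} :
    MemLp (fun ξ : Fin n → ℝ => Real.exp (-(1 / 4) * ∑ j, ξ j ^ 2)) 2 := by
  rw [memLp_two_iff_integrable_sq (Continuous.aestronglyMeasurable (by fun_prop))]
  refine (integrable_exp_neg_sum_sq (b := 1 / 2) (by norm_num)).congr (.of_forall fun w => ?_)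
  simp only [← Real.exp_nat_mul]
  ring_nf

lemma memLp_bargmannKernel {n : ℕ} (z : Fin n → ℂ) : MemLp (bargmannKernel z) 2 := by
  refine (memLp_exp_neg_sum_sq.const_mul
    (Real.pi ^ (-(n : ℝ) / 4) * Real.exp (n * ((‖z‖ + 1) ^ 2 + ‖z‖ ^ 2 / 4)))).mono'
    (continuous_bargmannKernel z).aestronglyMeasurable (.of_forall fun ξ => ?_)
  refine le_trans ?_ (norm_bargmannKernel_mul_exp_le le_rfl ξ)
  exact le_mul_of_one_le_right (norm_nonneg _) (Real.one_le_exp (by positivity))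

/-- The Bargmann transform. -/
def bargmann {n : ℕ} (f : (Fin n → ℝ) → ℂ) (z : Fin n → ℂ) : ℂ := ∫ ξ, f ξ * bargmannKernel z ξ

lemma integrable_mul_bargmannKernel {n : ℕ} {f : (Fin n → ℝ) → ℂ} (hf : MemLp f 2)
    (z : Fin n → ℂ) : Integrable fun ξ => f ξ * bargmannKernel z ξ :=
  hf.integrable_mul (memLp_bargmannKernel z)

lemma bargmann_congr {n : ℕ} {f g : (Fin n → ℝ) → ℂ} (h : f =ᵐ[volume] g) :
    bargmann f = bargmann g := by
  ext z
  exact integral_congr_ae (h.mono fun ξ hξ => by simp only [hξ])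

lemma hasFDerivAt_bargmannKernel {n : ℕ} (z : Fin n → ℂ) (ξ : Fin n → ℝ) :
    HasFDerivAt (fun z => bargmannKernel z ξ) (bargmannKernel z ξ •
      ∑ j, (Complex.I * ξ j + z j / 2) • ContinuousLinearMap.proj (R := ℂ) (φ := fun _ : Fin n => ℂ) j) z := by
  have h : HasFDerivAt (fun z : Fin n → ℂ =>
      ∑ j, (-(ξ j : ℂ) ^ 2 / 2 + Complex.I * z j * ξ j + z j ^ 2 / 4))
      (∑ j, (Complex.I * ξ j + z j / 2) •
        ContinuousLinearMap.proj (R := ℂ) (φ := fun _ : Fin n => ℂ) j) z := by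
    refine HasFDerivAt.fun_sum fun j _ => ?_
    have hj : HasDerivAt (fun t : ℂ => -(ξ j : ℂ) ^ 2 / 2 + Complex.I * t * ξ j + t ^ 2 / 4)
        (Complex.I * ξ j + z j / 2) (z j) := by
      have h1 := (((hasDerivAt_id (z j)).const_mul Complex.I).mul_const (ξ j : ℂ)).const_add
        (-(ξ j : ℂ) ^ 2 / 2)
      have h2 := ((hasDerivAt_id (z j)).pow 2).div_const 4
      refine (h1.add h2).congr_deriv ?_
      simp
      ring
    exact hj.comp_hasFDerivAt z
      (ContinuousLinearMap.proj (R := ℂ) (φ := fun _ : Fin n => ℂ) j).hasFDerivAt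
  have := h.cexp.const_mul ((Real.pi ^ (-(n : ℝ) / 4) : ℝ) : ℂ)
  rw [smul_smul] at this
  exact this

lemma differentiable_bargmann {n : ℕ} {f : (Fin n → ℝ) → ℂ} (hf : MemLp f 2) :
    Differentiable ℂ (bargmann f) := by
  intro z₀
  set R := ‖z₀‖ + 1
  set M := Real.pi ^ (-(n : ℝ) / 4) * Real.exp (n * ((R + 1) ^ 2 + R ^ 2 / 4))
  have hbound : ∀ ξ : Fin n → ℝ, ∀ z ∈ Metric.ball z₀ 1,
      ‖f ξ • (bargmannKernel z ξ • ∑ j, (Complex.I * ξ j + z j / 2) •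
        ContinuousLinearMap.proj (R := ℂ) (φ := fun _ : Fin n => ℂ) j)‖
      ≤ ‖f ξ‖ * (Real.exp (n * R) * M * Real.exp (-(1 / 4) * ∑ j, ξ j ^ 2)) := by
    intro ξ z hz
    have hzR : ‖z‖ ≤ R := by
      have := norm_le_norm_add_norm_sub' z z₀
      rw [mem_ball_iff_norm] at hz
      linarith
    rw [norm_smul, norm_smul]
    refine mul_le_mul_of_nonneg_left ?_ (norm_nonneg _)
    have hsum : ‖∑ j, (Complex.I * ξ j + z j / 2) •
        ContinuousLinearMap.proj (R := ℂ) (φ := fun _ : Fin n => ℂ) j‖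
        ≤ Real.exp (n * R) * Real.exp (∑ j, |ξ j|) := by
      calc _ ≤ ∑ j : Fin n, (R + |ξ j|) := by
            refine norm_sum_le_of_le _ fun j _ => ?_
            rw [norm_smul]
            have h1 : ‖ContinuousLinearMap.proj (R := ℂ) (φ := fun _ : Fin n => ℂ) j‖ ≤ 1 :=
              ContinuousLinearMap.opNorm_le_bound _ zero_le_one fun x => by
                simpa using norm_le_pi_norm x j
            have h2 : ‖Complex.I * ξ j + z j / 2‖ ≤ R + |ξ j| := by
              refine (norm_add_le _ _).trans ?_
              have := (norm_le_pi_norm z j).trans hzR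
              simp only [norm_mul, Complex.norm_I, one_mul, Complex.norm_real, Real.norm_eq_abs,
                norm_div, Complex.norm_ofNat]
              linarith [norm_nonneg (z j)]
            calc _ ≤ (R + |ξ j|) * 1 := by gcongr
              _ = _ := mul_one _
        _ = n * R + ∑ j, |ξ j| := by simp [Finset.sum_add_distrib]
        _ ≤ Real.exp (n * R + ∑ j, |ξ j|) := by linarith [Real.add_one_le_exp (n * R + ∑ j, |ξ j|)]
        _ = _ := Real.exp_add _ _
    calc _ ≤ ‖bargmannKernel z ξ‖ * (Real.exp (n * R) * Real.exp (∑ j, |ξ j|)) := by gcongr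
      _ = Real.exp (n * R) * (‖bargmannKernel z ξ‖ * Real.exp (∑ j, |ξ j|)) := by ring
      _ ≤ Real.exp (n * R) * (M * Real.exp (-(1 / 4) * ∑ j, ξ j ^ 2)) := by
          exact mul_le_mul_of_nonneg_left (norm_bargmannKernel_mul_exp_le hzR ξ) (by positivity)
      _ = _ := by ring
  refine (hasFDerivAt_integral_of_dominated_of_fderiv_le (𝕜 := ℂ) (μ := volume)
    (F := fun z ξ => f ξ * bargmannKernel z ξ) (Metric.ball_mem_nhds z₀ one_pos)
    (.of_forall fun z => (integrable_mul_bargmannKernel hf z).aestronglyMeasurable)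
    (integrable_mul_bargmannKernel hf z₀) ?_ (.of_forall hbound) ?_
    (.of_forall fun ξ z _ => (hasFDerivAt_bargmannKernel z ξ).const_mul (f ξ))).differentiableAt
  · refine hf.1.smul (Continuous.aestronglyMeasurable ?_)
    have := continuous_bargmannKernel z₀
    fun_prop
  · exact hf.norm.integrable_mul (memLp_exp_neg_sum_sq.const_mul _)

/-- The exponential `w ↦ exp(-a · w / 2)`, the Bargmann transform of `bargmannKernel a`. -/
def fockExp {n : ℕ} (a w : Fin n → ℂ) : ℂ := Complex.exp (-(1 / 2) * bilin a w)

lemma differentiable_fockExp {n : ℕ} (a : Fin n → ℂ) : Differentiable ℂ (fockExp a) :=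
  ((differentiable_bilin a).const_mul _).cexp

lemma bargmann_bargmannKernel {n : ℕ} (a : Fin n → ℂ) :
    bargmann (bargmannKernel a) = fockExp a := by
  ext z
  exact integral_bargmannKernel_mul a z

lemma memLp_cexp_bilin {n : ℕ} (c : ℂ) (a : Fin n → ℂ) :
    MemLp (fun w => Complex.exp (c * bilin a w)) 2 (fockMeasure n) := by
  refine memLp_of_norm_le_exp ((differentiable_bilin a).const_mul c).cexp.continuous 1 (‖c • a‖)
    fun w => ?_
  have h : c * bilin a w = bilin (c • a) w := by simp [bilin, Finset.mul_sum, mul_assoc]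
  rw [one_mul, Complex.norm_exp, h]
  exact Real.exp_le_exp.2 ((le_abs_self _).trans (abs_re_bilin_le _ w))

lemma memLp_cexp_bilin_conj {n : ℕ} (c : ℂ) (a : Fin n → ℂ) :
    MemLp (fun w => Complex.exp (c * bilin a (conjVec w))) 2 (fockMeasure n) :=
  (memLp_cexp_bilin c a).comp_measurePreserving (measurePreserving_fockMeasure Complex.conjLIE)

lemma memLp_fockExp {n : ℕ} (a : Fin n → ℂ) : MemLp (fockExp a) 2 (fockMeasure n) :=
  memLp_cexp_bilin _ a

lemma conj_fockExp {n : ℕ} (a w : Fin n → ℂ) :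
    conj (fockExp a w) = Complex.exp (1 / 2 * bilin (-conjVec a) (conjVec w)) := by
  rw [fockExp, ← Complex.exp_conj]
  congr 1
  simp [bilin, conjVec, map_ofNat]

lemma integral_mul_conj_fockExp {n : ℕ} {F : (Fin n → ℂ) → ℂ} (hF : F ∈ FockSpace n)
    (a : Fin n → ℂ) :
    ∫ w, F w * conj (fockExp a w) ∂fockMeasure n = F (-conjVec a) := by
  simp only [conj_fockExp]
  exact integral_mul_exp_conj hF.1 _ (hF.2.integrable_mul (memLp_cexp_bilin_conj _ _))

/-! ### Fourier uniqueness and density of the kernels -/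

/-- The positive and negative parts of `u` are densities of two finite measures with the same
characteristic function, hence of the same measure; the two parts then agree a.e., and one of them
is always zero. -/
lemma ae_eq_zero_of_fourier_eq_zero_real {n : ℕ} {u : (Fin n → ℝ) → ℝ} (hu : Integrable u)
    (h : ∀ a : Fin n → ℝ, ∫ ξ, (u ξ : ℂ) * Complex.exp (((ξ ⬝ᵥ a : ℝ) : ℂ) * Complex.I) = 0) :
    u =ᵐ[volume] 0 := by
  have := isFiniteMeasure_withDensity_ofReal hu.2
  have := isFiniteMeasure_withDensity_ofReal hu.neg.2
  have hm : AEMeasurable (fun ξ => ENNReal.ofReal (u ξ)) := hu.aemeasurable.ennreal_ofReal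
  have hm' : AEMeasurable (fun ξ => ENNReal.ofReal ((-u) ξ)) := hu.neg.aemeasurable.ennreal_ofReal
  have hE : ∀ a : Fin n → ℝ,
      Continuous fun ξ : Fin n → ℝ => Complex.exp (((ξ ⬝ᵥ a : ℝ) : ℂ) * Complex.I) := by
    intro a; unfold dotProduct; fun_prop
  have hmul : ∀ v : (Fin n → ℝ) → ℝ, Integrable v → ∀ a : Fin n → ℝ, Integrable fun ξ =>
      (((v ξ ⊔ 0 : ℝ)) : ℂ) * Complex.exp (((ξ ⬝ᵥ a : ℝ) : ℂ) * Complex.I) := by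
    intro v hv a
    refine (hv.pos_part.ofReal (𝕜 := ℂ)).mul_bdd (c := 1) (hE a).aestronglyMeasurable
      (.of_forall fun ξ => ?_)
    rw [Complex.norm_exp_ofReal_mul_I]
  have hP : (volume.withDensity fun ξ => ENNReal.ofReal (u ξ)) =
      volume.withDensity fun ξ => ENNReal.ofReal ((-u) ξ) := by
    refine ext_of_integral_char_eq (e := Real.probChar)
      Real.continuous_probChar Real.probChar_ne_one
      (L := dotProductBilin ℝ ℝ) (fun v hv h0 => hv ?_) ?_ fun a => ?_
    · exact dotProduct_self_eq_zero.1 (LinearMap.congr_fun h0 v)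
    · change Continuous fun p : (Fin n → ℝ) × (Fin n → ℝ) => p.1 ⬝ᵥ p.2
      fun_prop
    · rw [integral_withDensity_eq_integral_toReal_smul₀ hm (by simp),
        integral_withDensity_eq_integral_toReal_smul₀ hm' (by simp), ← sub_eq_zero,
        ← integral_sub]
      · refine (integral_congr_ae (.of_forall fun ξ => ?_)).trans (h a)
        rw [← sub_smul, ENNReal.toReal_ofReal', ENNReal.toReal_ofReal', Pi.neg_apply,
          max_zero_sub_max_neg_zero_eq_self, Complex.real_smul]
        rfl
      · exact hmul u hu a
      · exact hmul (-u) hu.neg a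
  rw [withDensity_eq_iff hm hm' hu.lintegral_lt_top.ne] at hP
  filter_upwards [hP] with ξ hξ
  rcases le_total 0 (u ξ) with h0 | h0
  · exact le_antisymm (by simpa [ENNReal.ofReal_of_nonpos (neg_nonpos.2 h0)] using hξ) h0
  · exact le_antisymm h0 (by simpa [ENNReal.ofReal_of_nonpos h0] using hξ.symm)

/-- Conjugation sends the frequency a to -a, so the transforms of the real and imaginary parts
vanish too. -/
lemma ae_eq_zero_of_fourier_eq_zero {n : ℕ} {u : (Fin n → ℝ) → ℂ} (hu : Integrable u)
    (h : ∀ a : Fin n → ℝ, ∫ ξ, u ξ * Complex.exp (((ξ ⬝ᵥ a : ℝ) : ℂ) * Complex.I) = 0) :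
    u =ᵐ[volume] 0 := by
  have hE : ∀ a : Fin n → ℝ,
      Continuous fun ξ : Fin n → ℝ => Complex.exp (((ξ ⬝ᵥ a : ℝ) : ℂ) * Complex.I) := by
    intro a; unfold dotProduct; fun_prop
  have hi : ∀ a : Fin n → ℝ,
      Integrable fun ξ => u ξ * Complex.exp (((ξ ⬝ᵥ a : ℝ) : ℂ) * Complex.I) := by
    intro a
    refine hu.mul_bdd (c := 1) (hE a).aestronglyMeasurable (.of_forall fun ξ => ?_)
    rw [Complex.norm_exp_ofReal_mul_I]
  have hc : ∀ (a : Fin n → ℝ) (ξ : Fin n → ℝ),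
      conj (u ξ * Complex.exp (((ξ ⬝ᵥ (-a) : ℝ) : ℂ) * Complex.I)) =
        conj (u ξ) * Complex.exp (((ξ ⬝ᵥ a : ℝ) : ℂ) * Complex.I) := by
    intro a ξ
    rw [map_mul, ← Complex.exp_conj]
    simp
  have hci : ∀ a : Fin n → ℝ,
      Integrable fun ξ => conj (u ξ) * Complex.exp (((ξ ⬝ᵥ a : ℝ) : ℂ) * Complex.I) := fun a => by
    simp only [← hc a]
    exact Complex.conjCLE.toContinuousLinearMap.integrable_comp (hi (-a))
  have h' : ∀ a : Fin n → ℝ,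
      ∫ ξ, conj (u ξ) * Complex.exp (((ξ ⬝ᵥ a : ℝ) : ℂ) * Complex.I) = 0 := fun a => by
    simp only [← hc a]
    rw [integral_conj, h, map_zero]
  have hre := ae_eq_zero_of_fourier_eq_zero_real hu.re fun a => by
    have : ∀ ξ : Fin n → ℝ, ((RCLike.re (u ξ) : ℝ) : ℂ) *
        Complex.exp (((ξ ⬝ᵥ a : ℝ) : ℂ) * Complex.I) =
        (u ξ * Complex.exp (((ξ ⬝ᵥ a : ℝ) : ℂ) * Complex.I) +
          conj (u ξ) * Complex.exp (((ξ ⬝ᵥ a : ℝ) : ℂ) * Complex.I)) * (1 / 2) := fun ξ => by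
      rw [RCLike.re_eq_complex_re, Complex.re_eq_add_conj]; ring
    simp only [this]
    rw [integral_mul_const, integral_add (hi a) (hci a), h, h']
    simp
  have him := ae_eq_zero_of_fourier_eq_zero_real hu.im fun a => by
    have : ∀ ξ : Fin n → ℝ, ((RCLike.im (u ξ) : ℝ) : ℂ) *
        Complex.exp (((ξ ⬝ᵥ a : ℝ) : ℂ) * Complex.I) =
        (u ξ * Complex.exp (((ξ ⬝ᵥ a : ℝ) : ℂ) * Complex.I) -
          conj (u ξ) * Complex.exp (((ξ ⬝ᵥ a : ℝ) : ℂ) * Complex.I)) * (1 / (2 * Complex.I)) :=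
      fun ξ => by
        rw [RCLike.im_eq_complex_im, Complex.im_eq_sub_conj]; ring
    simp only [this]
    rw [integral_mul_const, integral_sub (hi a) (hci a), h, h']
    simp
  filter_upwards [hre, him] with ξ h1 h2
  exact Complex.ext h1 h2

/-- A real vector regarded as a complex one. -/
def toComplexVec {n : ℕ} (a : Fin n → ℝ) : Fin n → ℂ := fun j => a j

lemma conjVec_toComplexVec {n : ℕ} (a : Fin n → ℝ) : conjVec (toComplexVec a) = toComplexVec a := by
  ext j; simp [conjVec, toComplexVec]

/-- The Bargmann kernel as an element of `L²(ℝⁿ)`. -/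
def bargmannLp {n : ℕ} (a : Fin n → ℂ) : Lp ℂ 2 (volume : Measure (Fin n → ℝ)) :=
  (memLp_bargmannKernel a).toLp

/-- The exponential `fockExp a` as an element of `L²(ν)`. -/
def fockExpLp {n : ℕ} (a : Fin n → ℂ) : Lp ℂ 2 (fockMeasure n) := (memLp_fockExp a).toLp

lemma inner_toLp {α : Type*} [MeasurableSpace α] {μ : Measure α} {f g : α → ℂ} (hf : MemLp f 2 μ)
    (hg : MemLp g 2 μ) : inner ℂ hf.toLp hg.toLp = ∫ x, g x * conj (f x) ∂μ := by
  rw [L2.inner_def]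
  refine integral_congr_ae ?_
  filter_upwards [hf.coeFn_toLp, hg.coeFn_toLp] with x h1 h2
  rw [h1, h2, RCLike.inner_apply]

lemma inner_bargmannLp {n : ℕ} (a b : Fin n → ℂ) :
    inner ℂ (bargmannLp a) (bargmannLp b) = inner ℂ (fockExpLp a) (fockExpLp b) := by
  rw [bargmannLp, bargmannLp, fockExpLp, fockExpLp, inner_toLp, inner_toLp,
    integral_mul_conj_fockExp ⟨differentiable_fockExp b, memLp_fockExp b⟩]
  simp only [conj_bargmannKernel]
  rw [integral_bargmannKernel_mul]
  rfl

/-- For real a, k_a is k_0 times a character times a constant. If h is orthogonal to all of them,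
the Fourier transform of the integrable function h k_0 vanishes, and k_0 has no zeros. -/
lemma span_bargmannLp_dense (n : ℕ) :
    (Submodule.span ℂ (Set.range fun a : Fin n → ℝ =>
      bargmannLp (toComplexVec a))).topologicalClosure = ⊤ := by
  rw [Submodule.topologicalClosure_eq_top_iff, Submodule.eq_bot_iff]
  intro h hh
  have h0 : (fun ξ => h ξ * bargmannKernel 0 ξ) =ᵐ[volume] 0 := by
    refine ae_eq_zero_of_fourier_eq_zero (integrable_mul_bargmannKernel (Lp.memLp h) 0) fun a => ?_
    have h1 : inner ℂ (bargmannLp (toComplexVec (-a))) h = 0 :=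
      (Submodule.mem_orthogonal _ _).1 hh _ (Submodule.subset_span ⟨_, rfl⟩)
    rw [← Lp.toLp_coeFn h (Lp.memLp h), bargmannLp, inner_toLp] at h1
    have h2 : ∀ ξ : Fin n → ℝ, h ξ * bargmannKernel 0 ξ *
        Complex.exp (((ξ ⬝ᵥ a : ℝ) : ℂ) * Complex.I) =
        (h ξ * conj (bargmannKernel (toComplexVec (-a)) ξ)) *
          Complex.exp (-∑ j, (a j : ℂ) ^ 2 / 4) := by
      intro ξ
      rw [conj_bargmannKernel, mul_assoc, mul_assoc, bargmannKernel, bargmannKernel, mul_assoc,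
        mul_assoc, ← Complex.exp_add, ← Complex.exp_add]
      congr 3
      rw [dotProduct, Complex.ofReal_sum, Finset.sum_mul, ← Finset.sum_add_distrib,
        ← sub_eq_add_neg, ← Finset.sum_sub_distrib]
      refine Finset.sum_congr rfl fun j _ => ?_
      simp [conjVec_toComplexVec]
      simp [toComplexVec]
      ring
    simp only [h2]
    rw [integral_mul_const, h1, zero_mul]
  rw [Lp.eq_zero_iff_ae_eq_zero]
  filter_upwards [h0] with ξ hξ
  exact (mul_eq_zero.1 hξ).resolve_right (bargmannKernel_ne_zero _ _)

/-! ### The Bargmann transform as an isometry onto the Fock space -/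

/-- Equal Gram matrices give equal norms to corresponding finite linear combinations, so the
correspondence is well defined on the span even when the vectors are dependent, and it extends by
density. -/
lemma exists_isometry_of_inner_eq {ι H K : Type*} [NormedAddCommGroup H] [InnerProductSpace ℂ H]
    [NormedAddCommGroup K] [InnerProductSpace ℂ K] [CompleteSpace K] {v : ι → H} {w : ι → K}
    (hd : (Submodule.span ℂ (Set.range v)).topologicalClosure = ⊤)
    (h : ∀ i j, inner ℂ (v i) (v j) = inner ℂ (w i) (w j)) :
    ∃ U : H →L[ℂ] K, (∀ i, U (v i) = w i) ∧ ∀ x, ‖U x‖ = ‖x‖ := by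
  have hnorm : ∀ c : ι →₀ ℂ, ‖Finsupp.linearCombination ℂ w c‖ = ‖Finsupp.linearCombination ℂ v c‖ := by
    intro c
    rw [@norm_eq_sqrt_re_inner ℂ, @norm_eq_sqrt_re_inner ℂ]
    simp only [Finsupp.linearCombination_apply, Finsupp.sum_inner, Finsupp.inner_sum,
      inner_smul_left, inner_smul_right, h]
  have hdense : DenseRange (Finsupp.linearCombination ℂ v) := by
    rw [← Finsupp.range_linearCombination] at hd
    rw [DenseRange, ← LinearMap.coe_range, ← Submodule.dense_iff_topologicalClosure_eq_top] at *
    exact hd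
  have hle : ∃ C, ∀ c : ι →₀ ℂ,
      ‖Finsupp.linearCombination ℂ w c‖ ≤ C * ‖Finsupp.linearCombination ℂ v c‖ :=
    ⟨1, fun c => by rw [hnorm, one_mul]⟩
  refine ⟨(Finsupp.linearCombination ℂ w).extendOfNorm (Finsupp.linearCombination ℂ v),
    fun i => ?_, fun x => ?_⟩
  · have := LinearMap.extendOfNorm_eq hdense hle (Finsupp.single i 1)
    simpa using this
  · refine hdense.induction_on x (isClosed_eq (by fun_prop) (by fun_prop)) fun c => ?_
    rw [LinearMap.extendOfNorm_eq hdense hle, hnorm]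

/-- Evaluation of the transform at `z` is the inner product with the kernel at -z̄, hence continuous
on L². -/
lemma tendsto_bargmann {n : ℕ} {f : ℕ → Lp ℂ 2 (volume : Measure (Fin n → ℝ))}
    {g : Lp ℂ 2 (volume : Measure (Fin n → ℝ))} (h : Filter.Tendsto f Filter.atTop (nhds g))
    (z : Fin n → ℂ) :
    Filter.Tendsto (fun k => bargmann (f k) z) Filter.atTop (nhds (bargmann g z)) := by
  have key : ∀ p : Lp ℂ 2 (volume : Measure (Fin n → ℝ)),
      bargmann p z = inner ℂ (bargmannLp (-conjVec z)) p := by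
    intro p
    conv_rhs => rw [← Lp.toLp_coeFn p (Lp.memLp p), bargmannLp, inner_toLp]
    have hz : -conjVec (-conjVec z) = z := by ext; simp [conjVec]
    simp only [conj_bargmannKernel, hz, bargmann]
  simp only [key]
  exact tendsto_const_nhds.inner h

/-- The Bargmann transform is an isometry from `L²(ℝⁿ)` to `L²(ν)`. -/
lemma exists_bargmann_isometry (n : ℕ) :
    ∃ U : Lp ℂ 2 (volume : Measure (Fin n → ℝ)) →L[ℂ] Lp ℂ 2 (fockMeasure n),
      (∀ f, U f =ᵐ[fockMeasure n] bargmann f) ∧ ∀ f, ‖U f‖ = ‖f‖ := by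
  obtain ⟨U, hU, hn⟩ := exists_isometry_of_inner_eq (span_bargmannLp_dense n)
    (w := fun a => fockExpLp (toComplexVec a)) fun a b => inner_bargmannLp _ _
  refine ⟨U, fun f => ?_, hn⟩
  have hspan : ∀ f ∈ Submodule.span ℂ (Set.range fun a : Fin n → ℝ => bargmannLp (toComplexVec a)),
      U f =ᵐ[fockMeasure n] bargmann f := by
    intro f hf
    induction hf using Submodule.span_induction with
    | mem f hf =>
      obtain ⟨a, rfl⟩ := hf
      simp only [hU]
      refine (memLp_fockExp _).coeFn_toLp.trans (.of_eq ?_)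
      rw [bargmannLp, bargmann_congr (memLp_bargmannKernel _).coeFn_toLp, bargmann_bargmannKernel]
    | zero =>
      rw [map_zero]
      refine (Lp.coeFn_zero _ _ _).trans (.of_eq ?_)
      rw [bargmann_congr (Lp.coeFn_zero _ _ _)]
      ext z
      simp [bargmann]
    | add f g _ _ hf hg =>
      rw [map_add]
      refine (Lp.coeFn_add _ _).trans ((hf.add hg).trans (.of_eq ?_))
      rw [bargmann_congr (Lp.coeFn_add f g)]
      ext z
      simp only [bargmann, Pi.add_apply, add_mul]
      rw [integral_add (integrable_mul_bargmannKernel (Lp.memLp f) z)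
        (integrable_mul_bargmannKernel (Lp.memLp g) z)]
    | smul c f _ hf =>
      rw [map_smul]
      refine (Lp.coeFn_smul _ _).trans ((hf.const_smul c).trans (.of_eq ?_))
      rw [bargmann_congr (Lp.coeFn_smul c f)]
      ext z
      simp only [bargmann, Pi.smul_apply, smul_eq_mul, mul_assoc]
      rw [integral_const_mul]
  have hf : f ∈ closure (Submodule.span ℂ
      (Set.range fun a : Fin n → ℝ => bargmannLp (toComplexVec a)) : Set _) := by
    rw [← Submodule.topologicalClosure_coe, span_bargmannLp_dense]
    trivial
  obtain ⟨s, hs, hlim⟩ := mem_closure_iff_seq_limit.1 hf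
  -- Along a subsequence the L² limit is also an a.e. pointwise limit, which can be compared with
  -- the pointwise convergence of the integrals.
  obtain ⟨ns, hns, hae⟩ := (tendstoInMeasure_of_tendsto_Lp
    ((U.continuous.tendsto f).comp hlim)).exists_seq_tendsto_ae
  have hall : ∀ᵐ w ∂fockMeasure n, ∀ k, U (s k) w = bargmann (s k) w :=
    ae_all_iff.2 fun k => hspan _ (hs k)
  filter_upwards [hae, hall] with w h1 h2
  refine tendsto_nhds_unique h1 ?_
  simp only [Function.comp_apply, h2]
  exact (tendsto_bargmann hlim w).comp hns.tendsto_atTop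

lemma bargmann_mem_fockSpace {n : ℕ} {f : (Fin n → ℝ) → ℂ} (hf : MemLp f 2) :
    bargmann f ∈ FockSpace n := by
  obtain ⟨U, hU, -⟩ := exists_bargmann_isometry n
  refine ⟨differentiable_bargmann hf, ?_⟩
  rw [← bargmann_congr hf.coeFn_toLp]
  exact (memLp_congr_ae (hU hf.toLp)).1 (Lp.memLp _)

lemma eLpNorm_bargmann {n : ℕ} {f : (Fin n → ℝ) → ℂ} (hf : MemLp f 2) :
    eLpNorm (bargmann f) 2 (fockMeasure n) = eLpNorm f 2 := by
  obtain ⟨U, hU, hn⟩ := exists_bargmann_isometry n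
  rw [← bargmann_congr hf.coeFn_toLp, ← eLpNorm_congr_ae (hU hf.toLp), ← Lp.enorm_def,
    ← eLpNorm_congr_ae hf.coeFn_toLp, ← Lp.enorm_def, ← ofReal_norm, ← ofReal_norm, hn]

/-- The Bargmann transform maps `L²(ℝⁿ)` onto the Fock space. -/
lemma exists_bargmann_eq {n : ℕ} {φ : (Fin n → ℂ) → ℂ} (hφ : φ ∈ FockSpace n) :
    ∃ h : (Fin n → ℝ) → ℂ, MemLp h 2 ∧ φ = bargmann h := by
  obtain ⟨U, hU, hn⟩ := exists_bargmann_isometry n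
  set Φ : Lp ℂ 2 (fockMeasure n) := hφ.2.toLp with hΦ
  set h := ContinuousLinearMap.adjoint U Φ with hh
  -- With h = U*Φ the remainder is orthogonal to the range of `U`, in particular to every
  -- exponential; by the reproducing property those inner products are its point values.
  have hr : φ - bargmann h ∈ FockSpace n :=
    Submodule.sub_mem _ hφ (bargmann_mem_fockSpace (Lp.memLp h))
  have hrU : hr.2.toLp = Φ - U h := by
    refine Lp.ext (hr.2.coeFn_toLp.trans ?_)
    refine .trans ?_ (Lp.coeFn_sub _ _).symm
    exact hφ.2.coeFn_toLp.symm.sub (hU h).symm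
  have hadj : ContinuousLinearMap.adjoint U ∘L U = 1 :=
    (ContinuousLinearMap.norm_map_iff_adjoint_comp_self U).1 hn
  refine ⟨h, Lp.memLp h, ?_⟩
  rw [← sub_eq_zero]
  ext z
  have hE : fockExpLp (-conjVec z) = U (bargmannLp (-conjVec z)) := by
    refine Lp.ext ((memLp_fockExp _).coeFn_toLp.trans ?_)
    refine .trans (.of_eq ?_) (hU _).symm
    rw [bargmannLp, bargmann_congr (memLp_bargmannKernel _).coeFn_toLp, bargmann_bargmannKernel]
  have h0 : inner ℂ (fockExpLp (-conjVec z)) hr.2.toLp = 0 := by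
    have h1 : ContinuousLinearMap.adjoint U (U h) = h := congr($hadj h)
    rw [hrU, hE, ← ContinuousLinearMap.adjoint_inner_right, map_sub, h1, hh, sub_self,
      inner_zero_right]
  rw [fockExpLp, inner_toLp, integral_mul_conj_fockExp hr] at h0
  have hz : -conjVec (-conjVec z) = z := by ext; simp [conjVec]
  rwa [hz] at h0

/-! ### S_φ as a multiplication operator -/

/-- Both sides have the same Gaussian and linear terms in ξ; the cross term of (a+b)²/4 is the
exponential. This converts translation of φ into multiplication on ℝⁿ. -/
lemma bargmannKernel_add {n : ℕ} (a b : Fin n → ℂ) (ξ : Fin n → ℝ) :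
    bargmannKernel 0 ξ * bargmannKernel (a + b) ξ =
      bargmannKernel a ξ * bargmannKernel b ξ * Complex.exp (1 / 2 * bilin a b) := by
  rw [bargmannKernel_mul, bargmannKernel_mul, mul_assoc, ← Complex.exp_add, bilin, Finset.mul_sum,
    ← Finset.sum_add_distrib]
  congr 2
  refine Finset.sum_congr rfl fun j _ => ?_
  simp only [Pi.zero_apply, Pi.add_apply]
  ring

lemma bilin_add_right {n : ℕ} (a b c : Fin n → ℂ) : bilin a (b + c) = bilin a b + bilin a c := by
  simp [bilin, mul_add, Finset.sum_add_distrib]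

lemma bilin_neg_left {n : ℕ} (a b : Fin n → ℂ) : bilin (-a) b = -bilin a b := by
  simp [bilin]

lemma conjVec_conjVec {n : ℕ} (w : Fin n → ℂ) : conjVec (conjVec w) = w := by
  ext; simp [conjVec]

lemma bilin_comm {n : ℕ} (a b : Fin n → ℂ) : bilin a b = bilin b a := by
  simp [bilin, mul_comm]

/-- `φ(z - w) exp(z · w / 2) exp(-a · w̄ / 2)` is `ν`-integrable in `w` for `φ` in the Fock space. -/
lemma integrable_reflect_mul_exp {n : ℕ} {φ : (Fin n → ℂ) → ℂ} (hφ : φ ∈ FockSpace n)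
    (z a : Fin n → ℂ) :
    Integrable (fun w => φ (z - w) * Complex.exp (1 / 2 * bilin z w) *
      Complex.exp (1 / 2 * bilin (-a) (conjVec w))) (fockMeasure n) := by
  rw [integrable_fockMeasure_translate z]
  have h1 : MemLp (fun u => φ (-u)) 2 (fockMeasure n) :=
    hφ.2.comp_measurePreserving (measurePreserving_fockMeasure (LinearIsometryEquiv.neg ℝ))
  -- After centring at `z`, φ(-u) is in L² and every other factor is at most exponential in |u|.
  have h2 : MemLp (fun u => Complex.exp (((-(1 / 2) * ∑ j, ‖z j‖ ^ 2 -
      (bilin (conjVec z) u).re : ℝ) : ℂ) + (1 / 2 * bilin z (z + u) +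
      1 / 2 * bilin (-a) (conjVec (z + u))))) 2 (fockMeasure n) := by
    refine memLp_of_norm_le_exp ?_ (Real.exp (1 / 2 * (bilin z z).re +
      1 / 2 * (bilin (-a) (conjVec z)).re)) (‖conjVec z‖ + 1 / 2 * ‖z‖ + 1 / 2 * ‖conjVec (-a)‖)
      fun u => ?_
    · unfold bilin conjVec; fun_prop
    · rw [Complex.norm_exp, ← Real.exp_add]
      refine Real.exp_le_exp.2 ?_
      have e1 := (neg_le_abs _).trans (abs_re_bilin_le (conjVec z) u)
      have e2 := (le_abs_self _).trans (abs_re_bilin_le z u)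
      have e3 := (le_abs_self _).trans (abs_re_bilin_le (conjVec (-a)) u)
      have e4 : (bilin (-a) (conjVec u)).re = (bilin (conjVec (-a)) u).re := by
        rw [← Complex.conj_re]
        simp [bilin, conjVec]
      have e5 : conjVec (z + u) = conjVec z + conjVec u := by ext; simp [conjVec]
      have e6 : 0 ≤ ∑ j, ‖z j‖ ^ 2 := by positivity
      have e7 : ∀ c : ℂ, (1 / 2 * c).re = 1 / 2 * c.re := fun c => by simp
      rw [e5, bilin_add_right, bilin_add_right]
      simp only [Complex.add_re, Complex.ofReal_re, e7, e4]
      nlinarith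
  refine (h1.integrable_mul h2).congr (.of_forall fun u => ?_)
  simp only [Pi.mul_apply, sub_add_cancel_left, Complex.real_smul, Complex.exp_add,
    Complex.ofReal_exp]
  ring

lemma integrable_fockExp_mul_kernelS {n : ℕ} {φ : (Fin n → ℂ) → ℂ} (hφ : φ ∈ FockSpace n)
    (a z : Fin n → ℂ) : Integrable (fun w => fockExp a w * kernelS φ z w) (fockMeasure n) := by
  rw [← integrable_fockMeasure_comp Complex.conjLIE]
  refine (integrable_reflect_mul_exp hφ z a).congr (.of_forall fun w => ?_)
  change φ (z - w) * Complex.exp (1 / 2 * bilin z w) *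
    Complex.exp (1 / 2 * bilin (-a) (conjVec w)) = fockExp a (conjVec w) * kernelS φ z (conjVec w)
  rw [kernelS, conjVec_conjVec, fockExp, bilin_neg_left]
  ring_nf

/-- Substituting w̄ for w makes the kernel of S_φ holomorphic in w and the exponential a reproducing
kernel at `-a`, so the integral is an evaluation. -/
lemma fockIntegralOp_fockExp {n : ℕ} {φ : (Fin n → ℂ) → ℂ} (hφ : φ ∈ FockSpace n)
    (a z : Fin n → ℂ) : fockIntegralOp (kernelS φ) (fockExp a) z =
      φ (z + a) * Complex.exp (-(1 / 2) * bilin z a) := by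
  have hd : Differentiable ℂ fun w => φ (z - w) * Complex.exp (1 / 2 * bilin z w) :=
    (hφ.1.comp (by fun_prop)).mul ((differentiable_bilin z).const_mul _).cexp
  have h := integral_mul_exp_conj hd (-a) (integrable_reflect_mul_exp hφ z a)
  rw [fockIntegralOp, ← integral_fockMeasure_comp Complex.conjLIE]
  calc _ = _ := integral_congr_ae (.of_forall fun w => ?_)
    _ = _ := h
    _ = _ := by rw [bilin_comm z, bilin_neg_left, bilin_comm a]; ring_nf
  change fockExp a (conjVec w) * kernelS φ z (conjVec w) = _
  rw [kernelS, conjVec_conjVec, fockExp, bilin_neg_left]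
  ring_nf

/-- On the span of the functions `bargmannKernel a`, `a` real, the operator `S_φ` acts as
multiplication by the quotient of the inverse Bargmann transform of `φ` by `bargmannKernel 0`. -/
lemma fockIntegralOp_bargmann_of_mem_span {n : ℕ} {h : (Fin n → ℝ) → ℂ} (hh : MemLp h 2)
    {g : Lp ℂ 2 (volume : Measure (Fin n → ℝ))}
    (hg : g ∈ Submodule.span ℂ (Set.range fun a : Fin n → ℝ => bargmannLp (toComplexVec a))) :
    MemLp (fun ξ => h ξ / bargmannKernel 0 ξ * g ξ) 2 ∧
      bargmann g ∈ fockOpDomain (kernelS (bargmann h)) ∧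
      fockIntegralOp (kernelS (bargmann h)) (bargmann g) =
        bargmann fun ξ => h ξ / bargmannKernel 0 ξ * g ξ := by
  have hφ := bargmann_mem_fockSpace hh
  induction hg using Submodule.span_induction with
  | mem g hg =>
    obtain ⟨a, rfl⟩ := hg
    have hcoe : (bargmannLp (toComplexVec a) : (Fin n → ℝ) → ℂ) =ᵐ[volume]
      bargmannKernel (toComplexVec a) := (memLp_bargmannKernel _).coeFn_toLp
    have hm : (fun ξ => h ξ / bargmannKernel 0 ξ * bargmannLp (toComplexVec a) ξ) =ᵐ[volume]
        fun ξ => h ξ / bargmannKernel 0 ξ * bargmannKernel (toComplexVec a) ξ :=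
      hcoe.mono fun ξ hξ => by simp only [hξ]
    simp only [bargmann_congr hcoe, bargmann_congr hm, bargmann_bargmannKernel]
    refine ⟨(memLp_congr_ae hm).2 ?_, ⟨⟨differentiable_fockExp _, memLp_fockExp _⟩,
      integrable_fockExp_mul_kernelS hφ _⟩, ?_⟩
    · refine hh.of_le_mul (c := Real.exp (∑ j, a j ^ 2 / 4)) ?_ (.of_forall fun ξ => ?_)
      · simp only [div_eq_mul_inv]
        exact (hh.1.mul ((continuous_bargmannKernel 0).inv₀
          (bargmannKernel_ne_zero 0)).aestronglyMeasurable).mul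
          (continuous_bargmannKernel _).aestronglyMeasurable
      -- For real `a` the quotient k_a/k_0 has constant modulus exp(∑ a_j²/4), so dividing by the
      -- Gaussian k_0 costs nothing here.
      · have h1 : bargmannKernel (toComplexVec a) ξ = bargmannKernel 0 ξ *
            Complex.exp (((∑ j, a j * ξ j : ℝ) : ℂ) * Complex.I + ((∑ j, a j ^ 2 / 4 : ℝ) : ℂ)) := by
          rw [bargmannKernel, bargmannKernel, mul_assoc, ← Complex.exp_add, Complex.ofReal_sum,
            Complex.ofReal_sum, Finset.sum_mul, ← Finset.sum_add_distrib,
            ← Finset.sum_add_distrib]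
          congr 2
          refine Finset.sum_congr rfl fun j _ => ?_
          simp [toComplexVec]
          ring
        rw [h1, ← mul_assoc, div_mul_cancel₀ _ (bargmannKernel_ne_zero 0 ξ), norm_mul,
          Complex.norm_exp, mul_comm]
        refine le_of_eq ?_
        congr 2
        rw [Complex.add_re, Complex.ofReal_re, Complex.re_ofReal_mul, Complex.I_re, mul_zero,
          zero_add]
    · ext z
      rw [fockIntegralOp_fockExp hφ, bargmann, bargmann, ← integral_mul_const]
      refine integral_congr_ae (.of_forall fun ξ => ?_)
      have h2 := bargmannKernel_add z (toComplexVec a) ξ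
      have h0 := div_mul_cancel₀ (h ξ) (bargmannKernel_ne_zero (0 : Fin n → ℂ) ξ)
      have h3 : Complex.exp (1 / 2 * bilin z (toComplexVec a)) *
          Complex.exp (-(1 / 2) * bilin z (toComplexVec a)) = 1 := by
        rw [← Complex.exp_add]; simp
      dsimp only
      set q := h ξ / bargmannKernel 0 ξ
      linear_combination (-bargmannKernel (z + toComplexVec a) ξ *
          Complex.exp (-(1 / 2) * bilin z (toComplexVec a))) * h0 +
        q * Complex.exp (-(1 / 2) * bilin z (toComplexVec a)) * h2 +
        q * bargmannKernel z ξ * bargmannKernel (toComplexVec a) ξ * h3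
  | zero =>
    have h0 : bargmann (0 : (Fin n → ℝ) → ℂ) = 0 := by ext z; simp [bargmann]
    have hm : (fun ξ => h ξ / bargmannKernel 0 ξ *
        (0 : Lp ℂ 2 (volume : Measure (Fin n → ℝ))) ξ) =ᵐ[volume] 0 :=
      (Lp.coeFn_zero ℂ 2 volume).mono fun ξ hξ => by
        simp only [hξ, Pi.zero_apply, mul_zero]
    rw [bargmann_congr (Lp.coeFn_zero _ _ _), bargmann_congr hm, h0]
    refine ⟨(memLp_congr_ae hm).2 MemLp.zero, ⟨Submodule.zero_mem _, fun z => by simp⟩, ?_⟩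
    ext z
    simp [fockIntegralOp]
  | add f g _ _ hf hg =>
    obtain ⟨hf1, hf2, hf3⟩ := hf
    obtain ⟨hg1, hg2, hg3⟩ := hg
    have hm : (fun ξ => h ξ / bargmannKernel 0 ξ * (f + g) ξ) =ᵐ[volume]
        (fun ξ => h ξ / bargmannKernel 0 ξ * f ξ) + fun ξ => h ξ / bargmannKernel 0 ξ * g ξ :=
      (Lp.coeFn_add f g).mono fun ξ hξ => by
        simp only [hξ, Pi.add_apply, mul_add]
    have hadd : ∀ {u v : (Fin n → ℝ) → ℂ}, MemLp u 2 → MemLp v 2 →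
        bargmann (u + v) = bargmann u + bargmann v := by
      intro u v hu hv
      ext z
      simp only [bargmann, Pi.add_apply, add_mul]
      rw [integral_add (integrable_mul_bargmannKernel hu z) (integrable_mul_bargmannKernel hv z)]
    have hint : ∀ z w, (bargmann f + bargmann g) w * kernelS (bargmann h) z w =
        bargmann f w * kernelS (bargmann h) z w + bargmann g w * kernelS (bargmann h) z w :=
      fun z w => add_mul _ _ _
    rw [bargmann_congr (Lp.coeFn_add f g), bargmann_congr hm, hadd (Lp.memLp f) (Lp.memLp g),
      hadd hf1 hg1]
    refine ⟨(memLp_congr_ae hm).2 (hf1.add hg1), ⟨Submodule.add_mem _ hf2.1 hg2.1, fun z => ?_⟩, ?_⟩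
    · simp only [hint]
      exact (hf2.2 z).add (hg2.2 z)
    · rw [← hf3, ← hg3]
      ext z
      simp only [fockIntegralOp, hint]
      exact integral_add (hf2.2 z) (hg2.2 z)
  | smul c g _ hg =>
    obtain ⟨hg1, hg2, hg3⟩ := hg
    have hm : (fun ξ => h ξ / bargmannKernel 0 ξ * (c • g) ξ) =ᵐ[volume]
        c • fun ξ => h ξ / bargmannKernel 0 ξ * g ξ :=
      (Lp.coeFn_smul c g).mono fun ξ hξ => by
        simp only [hξ, Pi.smul_apply, smul_eq_mul]; ring
    have hsmul : ∀ u : (Fin n → ℝ) → ℂ, bargmann (c • u) = c • bargmann u := by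
      intro u
      ext z
      simp only [bargmann, Pi.smul_apply, smul_eq_mul, mul_assoc]
      rw [integral_const_mul]
    have hint : ∀ z w, (c • bargmann g) w * kernelS (bargmann h) z w =
        c * (bargmann g w * kernelS (bargmann h) z w) :=
      fun z w => mul_assoc _ _ _
    rw [bargmann_congr (Lp.coeFn_smul c g), bargmann_congr hm, hsmul, hsmul]
    refine ⟨(memLp_congr_ae hm).2 (hg1.const_smul c), ⟨Submodule.smul_mem _ c hg2.1, fun z => ?_⟩, ?_⟩
    · simp only [hint]
      exact (hg2.2 z).const_mul c
    · rw [← hg3]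
      ext z
      simp only [fockIntegralOp, hint]
      exact integral_const_mul _ _

/-! ### Bounded multipliers and the characterisation of bounded S_φ -/

/-- Fatou along an a.e. convergent subsequence; `m` need not be known to multiply L² into itself
beforehand. -/
lemma eLpNorm_mul_le_of_mem_closure {α : Type*} [MeasurableSpace α] {μ : Measure α} {m : α → ℂ}
    (hm : AEStronglyMeasurable m μ) {C : ℝ≥0} {s : Set (Lp ℂ 2 μ)}
    (hs : ∀ g ∈ s, eLpNorm (fun x => m x * g x) 2 μ ≤ C * eLpNorm g 2 μ) {g : Lp ℂ 2 μ}
    (hg : g ∈ closure s) : eLpNorm (fun x => m x * g x) 2 μ ≤ C * eLpNorm g 2 μ := by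
  obtain ⟨u, hu, hlim⟩ := mem_closure_iff_seq_limit.1 hg
  obtain ⟨ns, hns, hae⟩ := (tendstoInMeasure_of_tendsto_Lp hlim).exists_seq_tendsto_ae
  have h1 := Lp.eLpNorm_lim_le_liminf_eLpNorm (p := 2) (μ := μ)
    (f := fun k x => m x * u (ns k) x)
    (fun k => hm.mul (Lp.aestronglyMeasurable _)) (fun x => m x * g x)
    (hae.mono fun x hx => hx.const_mul (m x))
  have h2 : Filter.Tendsto (fun k => C * eLpNorm (u (ns k)) 2 μ) Filter.atTop
      (nhds (C * eLpNorm g 2 μ)) := by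
    refine ENNReal.Tendsto.const_mul ?_ (.inr ENNReal.coe_ne_top)
    simp only [← Lp.enorm_def]
    exact (hlim.comp hns.tendsto_atTop).enorm
  refine h1.trans (le_trans ?_ h2.liminf_eq.le)
  exact Filter.liminf_le_liminf (.of_forall fun k => hs _ (hu _))

/-- Testing on indicators gives ∫_s |m|² ≤ C² μ(s) for every s of finite measure, hence |m| ≤ C a.e.
by σ-finiteness. -/
lemma memLp_top_of_eLpNorm_mul_le {α : Type*} [MeasurableSpace α] {μ : Measure α} [SigmaFinite μ]
    {m : α → ℂ} (hm : AEStronglyMeasurable m μ) {C : ℝ≥0}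
    (h : ∀ g : Lp ℂ 2 μ, eLpNorm (fun x => m x * g x) 2 μ ≤ C * eLpNorm g 2 μ) :
    MemLp m ∞ μ := by
  have key : (fun x => ‖m x‖ₑ ^ (2 : ℝ)) ≤ᵐ[μ] fun _ => (C : ℝ≥0∞) ^ (2 : ℝ) := by
    refine ae_le_of_forall_setLIntegral_le_of_sigmaFinite₀ (hm.enorm.pow_const _) fun s hs hμ => ?_
    have hi : MemLp (s.indicator fun _ => (1 : ℂ)) 2 μ := memLp_indicator_const 2 hs 1 (.inr hμ.ne)
    have h1 := h hi.toLp
    have h2 : (fun x => m x * (hi.toLp : Lp ℂ 2 μ) x) =ᵐ[μ] s.indicator m := by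
      filter_upwards [hi.coeFn_toLp] with x hx
      rw [hx]
      by_cases hxs : x ∈ s <;> simp [hxs]
    rw [eLpNorm_congr_ae h2, eLpNorm_congr_ae hi.coeFn_toLp] at h1
    have h3 := ENNReal.rpow_le_rpow h1 (z := 2) (by norm_num)
    rw [ENNReal.mul_rpow_of_nonneg _ _ (by norm_num)] at h3
    have h4 : ∀ f : α → ℂ, eLpNorm (s.indicator f) 2 μ ^ (2 : ℝ) =
        ∫⁻ x in s, ‖f x‖ₑ ^ (2 : ℝ) ∂μ := by
      intro f
      rw [eLpNorm_indicator_eq_eLpNorm_restrict hs]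
      have := eLpNorm_nnreal_pow_eq_lintegral (f := f) (p := 2) (μ := μ.restrict s) (by norm_num)
      simpa using! this
    rw [h4, h4] at h3
    simpa using h3
  refine memLp_top_of_bound hm C ?_
  filter_upwards [key] with x hx
  have := (ENNReal.rpow_le_rpow_iff (by norm_num : (0 : ℝ) < 2)).1 hx
  rw [← ofReal_norm, ENNReal.ofReal_le_iff_le_toReal (by simp)] at this
  simpa using this

/-- If `S_φ` is bounded, then `φ` is the Gaussian average of a bounded function. -/
lemma exists_symbol_of_isBoundedOnFock {n : ℕ} {φ : (Fin n → ℂ) → ℂ} (hφ : φ ∈ FockSpace n)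
    (hb : IsBoundedOnFock (kernelS φ)) :
    ∃ m : (Fin n → ℝ) → ℂ, MemLp m ∞ volume ∧
      ∀ z, φ z = ∫ ξ, m ξ * Complex.exp (-shiftSq (Complex.I / 2) ξ z) := by
  obtain ⟨h, hh, rfl⟩ := exists_bargmann_eq hφ
  obtain ⟨C, hC⟩ := hb
  have hmeas : AEStronglyMeasurable (fun ξ => h ξ / bargmannKernel 0 ξ) := by
    simp only [div_eq_mul_inv]
    exact hh.1.mul ((continuous_bargmannKernel 0).inv₀
      (bargmannKernel_ne_zero 0)).aestronglyMeasurable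
  have hm : MemLp (fun ξ => h ξ / bargmannKernel 0 ξ) ∞ := by
    refine memLp_top_of_eLpNorm_mul_le hmeas (C := C) fun g => ?_
    refine eLpNorm_mul_le_of_mem_closure hmeas (s := (Submodule.span ℂ
      (Set.range fun a : Fin n → ℝ => bargmannLp (toComplexVec a)) : Set _)) (fun g hg => ?_) ?_
    · obtain ⟨h1, h2, h3⟩ := fockIntegralOp_bargmann_of_mem_span hh hg
      have := (hC _ h2).2
      rwa [h3, eLpNorm_bargmann h1, eLpNorm_bargmann (Lp.memLp g)] at this
    · rw [← Submodule.topologicalClosure_coe, span_bargmannLp_dense]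
      trivial
  refine ⟨_, hm.const_mul ((Real.pi ^ (-(n : ℝ) / 2) : ℝ) : ℂ), fun z => ?_⟩
  refine integral_congr_ae (.of_forall fun ξ => ?_)
  have h0 := div_mul_cancel₀ (h ξ) (bargmannKernel_ne_zero (0 : Fin n → ℂ) ξ)
  have h1 := bargmannKernel_zero_mul z ξ
  dsimp only
  set q := h ξ / bargmannKernel 0 ξ
  linear_combination (-bargmannKernel z ξ) * h0 + q * h1

/-- If `φ` is the Gaussian average of a bounded function, then `S_φ` is bounded and everywhere
defined. -/
lemma isBoundedOnFock_of_symbol {n : ℕ} {φ : (Fin n → ℂ) → ℂ} {m : (Fin n → ℝ) → ℂ}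
    (hm : MemLp m ∞ volume)
    (hφ : ∀ z, φ z = ∫ ξ, m ξ * Complex.exp (-shiftSq (Complex.I / 2) ξ z)) :
    IsBoundedOnFock (kernelS φ) ∧ ∀ F ∈ FockSpace n, F ∈ fockOpDomain (kernelS φ) := by
  obtain ⟨U, hU, hn⟩ := exists_bargmann_isometry n
  set c : ℂ := ((Real.pi ^ ((n : ℝ) / 2) : ℝ) : ℂ) with hc
  have hcinv : c * ((Real.pi ^ (-(n : ℝ) / 2) : ℝ) : ℂ) = 1 := by
    rw [hc, ← Complex.ofReal_mul, ← Real.rpow_add Real.pi_pos]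
    norm_num
    ring_nf
    simp
  obtain ⟨M, hM⟩ : ∃ M : ℝ≥0, ∀ᵐ ξ, ‖m ξ‖ ≤ M := by
    refine ⟨(eLpNorm m ∞ volume).toNNReal, ?_⟩
    rw [eLpNorm_exponent_top]
    have hlt := hm.2
    rw [eLpNorm_exponent_top] at hlt
    filter_upwards [ae_le_eLpNormEssSup (f := m) (μ := volume)] with ξ hξ
    rw [← ofReal_norm, ENNReal.ofReal_le_iff_le_toReal hlt.ne] at hξ
    exact hξ
  have hmul : ∀ {f : (Fin n → ℝ) → ℂ}, MemLp f 2 → MemLp (fun ξ => m ξ * f ξ) 2 := by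
    intro f hf
    refine hf.of_le_mul (c := M) (hm.1.mul hf.1) (hM.mono fun ξ hξ => ?_)
    rw [norm_mul]
    gcongr
  have hk : ∀ z, MemLp (fun ξ => conj (m ξ * bargmannKernel z ξ)) 2 :=
    fun z => (hmul (memLp_bargmannKernel z)).star
  -- The addition formula separates z from w̄, exhibiting the kernel as a conjugated Bargmann
  -- transform in `w`.
  have hkernel : ∀ z w, kernelS φ z w =
      c * conj (bargmann (fun ξ => conj (m ξ * bargmannKernel z ξ)) w) := by
    intro z w
    rw [kernelS, hφ, bargmann, ← integral_conj, ← integral_mul_const, ← integral_const_mul]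
    refine integral_congr_ae (.of_forall fun ξ => ?_)
    have h1 := bargmannKernel_zero_mul (z - conjVec w) ξ
    have h2 := bargmannKernel_add z (-conjVec w) ξ
    rw [← sub_eq_add_neg, h1, bilin_comm z, bilin_neg_left, bilin_comm _ z] at h2
    have h3 : Complex.exp (1 / 2 * -bilin z (conjVec w)) *
        Complex.exp (1 / 2 * bilin z (conjVec w)) = 1 := by
      rw [← Complex.exp_add]; simp
    simp only [map_mul, Complex.conj_conj, conj_bargmannKernel w]
    set E := Complex.exp (1 / 2 * bilin z (conjVec w))
    linear_combination (c * m ξ * E) * h2 - (m ξ *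
      Complex.exp (-shiftSq (Complex.I / 2) ξ (z - conjVec w)) * E) * hcinv +
      c * m ξ * bargmannKernel z ξ * bargmannKernel (-conjVec w) ξ * h3
  have hkL2 : ∀ z, MemLp (fun w => kernelS φ z w) 2 (fockMeasure n) := by
    intro z
    simp only [hkernel]
    exact ((bargmann_mem_fockSpace (hk z)).2.star).const_mul c
  have hdom : ∀ F ∈ FockSpace n, F ∈ fockOpDomain (kernelS φ) :=
    fun F hF => ⟨hF, fun z => hF.2.integrable_mul (hkL2 z)⟩
  refine ⟨⟨‖c‖₊ * M, fun F hF => ?_⟩, hdom⟩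
  have hF2 := hF.1.2
  set g := ContinuousLinearMap.adjoint U hF2.toLp with hg
  -- Pairing `F` with that transform and moving `U` to the other side gives multiplication by c·m of
  -- U*F.
  have hop : fockIntegralOp (kernelS φ) F = bargmann fun ξ => c * (m ξ * g ξ) := by
    ext z
    have h1 : U (hk z).toLp = (bargmann_mem_fockSpace (hk z)).2.toLp := by
      refine Lp.ext ((hU _).trans ?_)
      rw [bargmann_congr (hk z).coeFn_toLp]
      exact (MemLp.coeFn_toLp _).symm
    have h2 : inner ℂ (U (hk z).toLp) hF2.toLp = inner ℂ (hk z).toLp g :=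
      (ContinuousLinearMap.adjoint_inner_right U _ _).symm
    rw [h1, inner_toLp, ← Lp.toLp_coeFn g (Lp.memLp g), inner_toLp] at h2
    simp only [fockIntegralOp, hkernel, bargmann]
    calc _ = c * _ := by
          rw [← integral_const_mul]
          exact integral_congr_ae (.of_forall fun w => mul_left_comm _ _ _)
      _ = c * _ := congrArg (c * ·) h2
      _ = _ := by
          rw [← integral_const_mul]
          refine integral_congr_ae (.of_forall fun ξ => ?_)
          simp only [Complex.conj_conj]
          ring
  have hmg : MemLp (fun ξ => c * (m ξ * g ξ)) 2 := (hmul (Lp.memLp g)).const_mul c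
  rw [hop]
  refine ⟨bargmann_mem_fockSpace hmg, ?_⟩
  rw [eLpNorm_bargmann hmg]
  calc eLpNorm (fun ξ => c * (m ξ * g ξ)) 2 volume ≤ (‖c‖₊ * M : ℝ≥0) • eLpNorm g 2 volume := by
        refine eLpNorm_le_nnreal_smul_eLpNorm_of_ae_le_mul (hM.mono fun ξ hξ => ?_) 2
        rw [nnnorm_mul, nnnorm_mul, ← mul_assoc]
        gcongr
        exact hξ
    _ = (‖c‖₊ * M : ℝ≥0) * eLpNorm g 2 volume := rfl
    _ ≤ (‖c‖₊ * M : ℝ≥0) * eLpNorm F 2 (fockMeasure n) := by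
        gcongr
        rw [← eLpNorm_congr_ae hF2.coeFn_toLp, ← Lp.enorm_def, ← Lp.enorm_def, ← ofReal_norm,
          ← ofReal_norm]
        refine ENNReal.ofReal_le_ofReal ?_
        refine (ContinuousLinearMap.le_opNorm _ _).trans ?_
        refine mul_le_of_le_one_left (norm_nonneg _) ?_
        rw [LinearIsometryEquiv.norm_map]
        exact U.opNorm_le_bound zero_le_one fun x => by rw [hn, one_mul]

section PhragmenLindelof

open Complex in
-- With x + iy = exp ζ at angle θ in [0, a], B sin θ ≤ B a ≤ δ ≤ 2δ cos θ, so B y² ≤ 2δxy: near the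
-- real ray the damping beats the growth.
lemma norm_comp_exp_mul_le {f : ℂ → ℂ} {B C δ a : ℝ} (hB : 0 ≤ B) (ha : B * a ≤ δ)
    (ha' : a ≤ Real.pi / 8) (h : ∀ z, ‖f z‖ ≤ C * Real.exp (B * z.im ^ 2)) {ζ : ℂ}
    (h0 : 0 ≤ ζ.im) (hζ : ζ.im ≤ a) :
    ‖f (exp ζ)‖ * Real.exp (-(2 * δ * ((exp ζ).re * (exp ζ).im))) ≤ C := by
  have hpi := Real.pi_gt_three
  have hpi' := Real.pi_le_four
  have hC : 0 ≤ C := by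
    have := (norm_nonneg _).trans (h 0)
    simpa using this
  have hsin0 : 0 ≤ Real.sin ζ.im := Real.sin_nonneg_of_nonneg_of_le_pi h0 (by linarith)
  have hsin : Real.sin ζ.im ≤ a := (Real.sin_le h0).trans hζ
  have hcos : 1 / 2 ≤ Real.cos ζ.im := by
    rw [← Real.cos_pi_div_three]
    exact Real.cos_le_cos_of_nonneg_of_le_pi h0 (by linarith) (by linarith)
  have hδ : 0 ≤ δ := (mul_nonneg hB (h0.trans hζ)).trans ha
  have hle : B * (exp ζ).im ^ 2 - 2 * δ * ((exp ζ).re * (exp ζ).im) ≤ 0 := by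
    rw [exp_im, exp_re]
    have h1 : B * Real.sin ζ.im - 2 * δ * Real.cos ζ.im ≤ 0 := by nlinarith
    have h2 : 0 ≤ Real.exp ζ.re ^ 2 * Real.sin ζ.im := by positivity
    nlinarith
  calc _ ≤ C * Real.exp (B * (exp ζ).im ^ 2) *
        Real.exp (-(2 * δ * ((exp ζ).re * (exp ζ).im))) := by gcongr; exact h _
    _ = C * Real.exp (B * (exp ζ).im ^ 2 - 2 * δ * ((exp ζ).re * (exp ζ).im)) := by
        rw [mul_assoc, ← Real.exp_add, sub_eq_add_neg]
    _ ≤ C * 1 := by gcongr; exact Real.exp_le_one_iff.2 hle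
    _ = C := mul_one C

open Complex in
/-- An entire function of order two which is bounded by `exp(B x²)` and by `exp(B y²)` is bounded
on the first quadrant. -/
lemma norm_le_of_quadrant {f : ℂ → ℂ} (hf : Differentiable ℂ f) {B C : ℝ} (hB : 0 ≤ B)
    (hre : ∀ z, ‖f z‖ ≤ C * Real.exp (B * z.re ^ 2))
    (him : ∀ z, ‖f z‖ ≤ C * Real.exp (B * z.im ^ 2)) {z : ℂ} (hz : 0 ≤ z.re) (hz' : 0 ≤ z.im) :
    ‖f z‖ ≤ C := by
  rcases eq_or_ne z 0 with rfl | hne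
  · simpa using him 0
  have hpi := Real.pi_pos
  have hC : 0 ≤ C := by
    have := (norm_nonneg _).trans (him 0)
    simpa using this
  have hstrip : ∀ δ > 0, ‖f z‖ * Real.exp (-(2 * δ * (z.re * z.im))) ≤ C := by
    intro δ hδ
    -- The first bound gives B a ≤ δ; the second keeps cos ≥ 1/2 on the boundary sector and leaves a
    -- middle strip.
    set a := min (δ / (B + 1)) (Real.pi / 8) with ha
    have ha0 : 0 < a := lt_min (by positivity) (by positivity)
    have ha1 : a ≤ Real.pi / 8 := min_le_right _ _
    have hBa : B * a ≤ δ := by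
      have : a * (B + 1) ≤ δ := (le_div_iff₀ (by positivity)).1 (min_le_left _ _)
      nlinarith
    -- Logarithmic coordinates make the quadrant a strip of width π/2. The factor exp(iδw²) has
    -- modulus exp(-2δxy); δ tends to 0 at the end.
    set g : ℂ → ℂ := fun ζ => f (exp ζ) * exp (I * δ * exp ζ ^ 2) with hg
    have hgn : ∀ ζ, ‖g ζ‖ = ‖f (exp ζ)‖ * Real.exp (-(2 * δ * ((exp ζ).re * (exp ζ).im))) := by
      intro ζ
      simp only [hg]
      rw [norm_mul, norm_exp]
      congr 2
      simp only [mul_re, mul_im, I_re, I_im, ofReal_re, ofReal_im, pow_two]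
      ring
    have hlow : ∀ ζ : ℂ, 0 ≤ ζ.im → ζ.im ≤ a → ‖g ζ‖ ≤ C := fun ζ h0 h1 => by
      rw [hgn]
      exact norm_comp_exp_mul_le hB hBa ha1 him h0 h1
    have hhigh : ∀ ζ : ℂ, Real.pi / 2 - a ≤ ζ.im → ζ.im ≤ Real.pi / 2 → ‖g ζ‖ ≤ C := by
      intro ζ h0 h1
      -- Reflection in the diagonal exchanges the two bounds. It destroys holomorphy, which the
      -- sector estimate does not require.
      have h2 := norm_comp_exp_mul_le (f := fun w => f (w.im + w.re * I)) hB hBa ha1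
        (fun w => by simpa using hre (w.im + w.re * I)) (ζ := ζ.re + (Real.pi / 2 - ζ.im : ℝ) * I)
        (by simp; linarith) (by simp; linarith)
      have h3 : exp (ζ.re + (Real.pi / 2 - ζ.im : ℝ) * I) = (exp ζ).im + (exp ζ).re * I := by
        apply Complex.ext
        · simp only [exp_re, exp_im, add_re, add_im, ofReal_re, ofReal_im, mul_re, mul_im, I_re,
            I_im, mul_zero, mul_one, sub_zero, add_zero, zero_add, Real.cos_pi_div_two_sub]
        · simp only [exp_re, exp_im, add_re, add_im, ofReal_re, ofReal_im, mul_re, mul_im, I_re,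
            I_im, mul_zero, mul_one, sub_zero, add_zero, zero_add, Real.sin_pi_div_two_sub]
      rw [hgn]
      rw [h3] at h2
      have h4 : ((exp ζ).im + (exp ζ).re * I : ℂ).re = (exp ζ).im := by simp
      have h5 : ((exp ζ).im + (exp ζ).re * I : ℂ).im = (exp ζ).re := by simp
      simp only [h4, h5, re_add_im] at h2
      rwa [mul_comm (exp ζ).re]
    have hall : ∀ ζ : ℂ, 0 ≤ ζ.im → ζ.im ≤ Real.pi / 2 → ‖g ζ‖ ≤ C := by
      intro ζ h0 h1
      rcases le_total ζ.im a with h2 | h2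
      · exact hlow ζ h0 h2
      rcases le_total (Real.pi / 2 - a) ζ.im with h3 | h3
      · exact hhigh ζ h3 h1
      have hgd : Differentiable ℂ g := by
        have := hf.comp differentiable_exp
        exact this.mul (by fun_prop)
      -- The growth exponent 2 is critical for width π/2; removing the two sectors makes the strip
      -- narrower, so that 2 < π/(π/2 - 2a).
      refine PhragmenLindelof.horizontal_strip (a := a) (b := Real.pi / 2 - a) hgd.diffContOnCl
        ⟨2, ?_, B, ?_⟩ (fun w hw => hlow w (by linarith) hw.le)
        (fun w hw => hhigh w hw.ge (by linarith)) h2 h3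
      · rw [lt_div_iff₀ (by linarith)]
        linarith
      · refine Asymptotics.IsBigO.of_bound C ?_
        refine Filter.eventually_inf_principal.2 (.of_forall fun w hw => ?_)
        have hw1 : 0 ≤ w.im := ha0.le.trans hw.1.le
        have hw2 : w.im ≤ Real.pi / 2 := by linarith [hw.2]
        have hs : 0 ≤ Real.sin w.im := Real.sin_nonneg_of_nonneg_of_le_pi hw1 (by linarith)
        have hc : 0 ≤ Real.cos w.im := Real.cos_nonneg_of_neg_pi_div_two_le_of_le (by linarith) hw2
        rw [hgn, Real.norm_of_nonneg (Real.exp_pos _).le]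
        have h4 : Real.exp (-(2 * δ * ((exp w).re * (exp w).im))) ≤ 1 := by
          rw [Real.exp_le_one_iff, exp_re, exp_im]
          have : 0 ≤ 2 * δ * (Real.exp w.re * Real.cos w.im * (Real.exp w.re * Real.sin w.im)) := by
            positivity
          linarith
        have h5 : (exp w).im ^ 2 ≤ Real.exp (2 * |w.re|) := by
          rw [exp_im, mul_pow, ← Real.exp_nat_mul]
          calc _ ≤ Real.exp ((2 : ℕ) * w.re) * 1 := by
                gcongr
                exact Real.sin_sq_le_one _
            _ ≤ Real.exp (2 * |w.re|) := by
                rw [mul_one]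
                push_cast
                gcongr
                exact le_abs_self _
        calc _ ≤ C * Real.exp (B * (exp w).im ^ 2) * 1 := by
              gcongr
              exact him _
          _ ≤ C * Real.exp (B * Real.exp (2 * |w.re|)) := by
              rw [mul_one]
              gcongr
    have := hall (log z) (by rw [log_im]; exact arg_nonneg_iff.2 hz')
      (by rw [log_im]; exact arg_le_pi_div_two_iff.2 (.inl hz))
    rwa [hgn, exp_log hne] at this
  have hlim : Filter.Tendsto (fun δ : ℝ => ‖f z‖ * Real.exp (-(2 * δ * (z.re * z.im))))
      (nhdsWithin 0 (Set.Ioi 0)) (nhds (‖f z‖ * Real.exp (-(2 * 0 * (z.re * z.im))))) :=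
    (Continuous.tendsto (by fun_prop) _).mono_left nhdsWithin_le_nhds
  have := le_of_tendsto hlim (Filter.eventually_of_mem self_mem_nhdsWithin hstrip)
  simpa using this

open Complex in
-- Powers of i carry each quadrant to the first, odd powers exchanging the two bounds; then
-- Liouville applies.
lemma apply_eq_apply_of_norm_le_exp {f : ℂ → ℂ} (hf : Differentiable ℂ f) {B C : ℝ} (hB : 0 ≤ B)
    (hre : ∀ z, ‖f z‖ ≤ C * Real.exp (B * z.re ^ 2))
    (him : ∀ z, ‖f z‖ ≤ C * Real.exp (B * z.im ^ 2)) (z w : ℂ) : f z = f w := by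
  refine hf.apply_eq_apply_of_bounded ?_ z w
  refine (isBounded_iff_forall_norm_le).2 ⟨C, ?_⟩
  rintro _ ⟨z, rfl⟩
  rcases le_total 0 z.re with h1 | h1 <;> rcases le_total 0 z.im with h2 | h2
  · exact norm_le_of_quadrant hf hB hre him h1 h2
  · have := norm_le_of_quadrant (f := fun w => f (-I * w)) (hf.comp (by fun_prop)) hB
      (fun w => by simpa using him (-I * w)) (fun w => by simpa using hre (-I * w)) (z := I * z)
      (by simpa using h2) (by simpa using h1)
    simpa [← mul_assoc] using this
  · have := norm_le_of_quadrant (f := fun w => f (I * w)) (hf.comp (by fun_prop)) hB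
      (fun w => by simpa using him (I * w)) (fun w => by simpa using hre (I * w)) (z := -I * z)
      (by simpa using h2) (by simpa using h1)
    simpa [← mul_assoc] using this
  · have := norm_le_of_quadrant (f := fun w => f (-w)) (hf.comp (by fun_prop)) hB
      (fun w => by simpa using hre (-w)) (fun w => by simpa using him (-w)) (z := -z)
      (by simpa using h1) (by simpa using h2)
    simpa using this

end PhragmenLindelof

/-- An entire function on `ℂⁿ` bounded both by `exp(|Re z|²/4)` and by `exp(|Im z|²/4)` is
constant. -/
lemma apply_eq_apply_zero_of_norm_le_exp {n : ℕ} {φ : (Fin n → ℂ) → ℂ} (hφ : Differentiable ℂ φ)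
    {C : ℝ} (hre : ∀ z, ‖φ z‖ ≤ C * Real.exp (1 / 4 * ∑ j, (z j).re ^ 2))
    (him : ∀ z, ‖φ z‖ ≤ C * Real.exp (1 / 4 * ∑ j, (z j).im ^ 2)) (z : Fin n → ℂ) :
    φ z = φ 0 := by
  -- For real `a`, Re(l a) = (Re l) a and likewise for Im, so both bounds restrict to the line with
  -- B = |a|²/4.
  have hreal : ∀ a : Fin n → ℝ, φ (toComplexVec a) = φ 0 := by
    intro a
    have := apply_eq_apply_of_norm_le_exp (f := fun l : ℂ => φ (l • toComplexVec a))
      (hφ.comp (differentiable_id.smul_const _)) (B := 1 / 4 * ∑ j, a j ^ 2) (C := C)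
      (by positivity) (fun l => ?_) (fun l => ?_) 1 0
    · simpa using this
    · convert hre (l • toComplexVec a) using 3
      simp [toComplexVec, mul_pow, ← Finset.mul_sum]
      ring
    · convert him (l • toComplexVec a) using 3
      simp [toComplexVec, mul_pow, ← Finset.mul_sum]
      ring
  set x : Fin n → ℝ := fun j => (z j).re
  set y : Fin n → ℝ := fun j => (z j).im
  -- On the line x + l y the function is constant for real l, hence for all l; l = i gives z.
  have hd : Differentiable ℂ fun l : ℂ => φ (toComplexVec x + l • toComplexVec y) :=
    hφ.comp ((differentiable_id.smul_const _).const_add _)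
  have hline : ∀ t : ℝ, φ (toComplexVec x + (t : ℂ) • toComplexVec y) = φ 0 := fun t => by
    rw [← hreal (x + t • y)]
    congr 1
    ext j
    simp [toComplexVec]
  have hofReal : Filter.Tendsto (fun t : ℝ => (t : ℂ)) (nhdsWithin 0 {0}ᶜ) (nhdsWithin 0 {0}ᶜ) := by
    refine tendsto_nhdsWithin_iff.2 ⟨?_, ?_⟩
    · exact (Complex.continuous_ofReal.tendsto' 0 0 (by simp)).mono_left nhdsWithin_le_nhds
    · filter_upwards [self_mem_nhdsWithin] with t ht
      simpa using ht
  have hfreq : ∃ᶠ l : ℂ in nhdsWithin 0 {0}ᶜ,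
      φ (toComplexVec x + l • toComplexVec y) = (fun _ => φ 0) l :=
    hofReal.frequently (Filter.Frequently.of_forall hline)
  have heq := AnalyticOnNhd.eq_of_frequently_eq (z₀ := (0 : ℂ))
    (fun l _ => hd.analyticAt l) (fun l _ => analyticAt_const) hfreq
  have := congrFun heq Complex.I
  rw [← this]
  congr 1
  ext j
  simp [toComplexVec, x, y, mul_comm Complex.I]

/-- Re (ξ - iz/2)² = (ξ + Im z/2)² - (Re z)²/4 in each coordinate, and the integral of the shifted
Gaussian does not depend on z. -/
lemma norm_le_of_symbol {n : ℕ} {φ : (Fin n → ℂ) → ℂ} {m : (Fin n → ℝ) → ℂ}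
    (hm : MemLp m ∞ volume)
    (hφ : ∀ z, φ z = ∫ ξ, m ξ * Complex.exp (-shiftSq (Complex.I / 2) ξ z)) :
    ∃ C : ℝ, ∀ z, ‖φ z‖ ≤ C * Real.exp (1 / 4 * ∑ j, (z j).re ^ 2) := by
  obtain ⟨M, hM⟩ : ∃ M : ℝ, ∀ᵐ ξ, ‖m ξ‖ ≤ M := by
    have hlt := hm.2
    rw [eLpNorm_exponent_top] at hlt
    refine ⟨(eLpNormEssSup m volume).toReal, ?_⟩
    filter_upwards [ae_le_eLpNormEssSup (f := m) (μ := volume)] with ξ hξ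
    rwa [← ofReal_norm, ENNReal.ofReal_le_iff_le_toReal hlt.ne] at hξ
  refine ⟨M * ∫ ξ : Fin n → ℝ, Real.exp (-1 * ∑ j, ξ j ^ 2), fun z => ?_⟩
  set b : Fin n → ℝ := fun j => (z j).im / 2
  have hnorm : ∀ ξ : Fin n → ℝ, ‖Complex.exp (-shiftSq (Complex.I / 2) ξ z)‖ =
      Real.exp (-1 * ∑ j, (ξ + b) j ^ 2) * Real.exp (1 / 4 * ∑ j, (z j).re ^ 2) := by
    intro ξ
    rw [Complex.norm_exp, ← Real.exp_add, shiftSq, Complex.neg_re, Complex.re_sum, Finset.mul_sum,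
      Finset.mul_sum, ← Finset.sum_add_distrib, ← Finset.sum_neg_distrib]
    congr 1
    refine Finset.sum_congr rfl fun j _ => ?_
    simp [pow_two, b]
    ring
  have hint : Integrable fun ξ : Fin n → ℝ => Real.exp (-1 * ∑ j, (ξ + b) j ^ 2) :=
    (integrable_exp_neg_sum_sq one_pos).comp_add_right b
  rw [hφ, mul_assoc, mul_comm (integral _ _), ← mul_assoc,
    ← integral_add_right_eq_self (fun ξ : Fin n → ℝ => Real.exp (-1 * ∑ j, ξ j ^ 2)) b,
    ← integral_const_mul]
  refine norm_integral_le_of_norm_le (hint.const_mul _) (hM.mono fun ξ hξ => ?_)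
  rw [norm_mul, hnorm]
  have := mul_le_mul_of_nonneg_right hξ (by positivity :
    0 ≤ Real.exp (-1 * ∑ j, (ξ + b) j ^ 2) * Real.exp (1 / 4 * ∑ j, (z j).re ^ 2))
  linarith

/-! ### Rotations, and the passage from S_φ to S̃_φ -/

lemma rotation_apply_pi {n : ℕ} (c : Circle) :
    (fun (w : Fin n → ℂ) j => rotation c (w j)) = fun w => (c : ℂ) • w := by
  ext w j; simp [rotation_apply]

lemma measurePreserving_circle_smul {n : ℕ} (c : Circle) :
    MeasurePreserving (fun w : Fin n → ℂ => (c : ℂ) • w) (fockMeasure n) (fockMeasure n) := by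
  rw [← rotation_apply_pi]
  exact measurePreserving_fockMeasure _

lemma measurableEmbedding_circle_smul {n : ℕ} (c : Circle) :
    MeasurableEmbedding (fun w : Fin n → ℂ => (c : ℂ) • w) := by
  rw [← rotation_apply_pi]
  exact measurableEmbedding_isometry _

lemma comp_circle_smul_mem_fockSpace {n : ℕ} (c : Circle) {F : (Fin n → ℂ) → ℂ}
    (hF : F ∈ FockSpace n) : (fun w => F ((c : ℂ) • w)) ∈ FockSpace n :=
  ⟨hF.1.comp (by fun_prop), hF.2.comp_measurePreserving (measurePreserving_circle_smul c)⟩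

lemma eLpNorm_comp_circle_smul {n : ℕ} (c : Circle) {F : (Fin n → ℂ) → ℂ} (hF : F ∈ FockSpace n) :
    eLpNorm (fun w => F ((c : ℂ) • w)) 2 (fockMeasure n) = eLpNorm F 2 (fockMeasure n) :=
  eLpNorm_comp_measurePreserving hF.2.1 (measurePreserving_circle_smul c)

lemma comp_circle_smul_mem_fockOpDomain {n : ℕ} (c : Circle) {K : (Fin n → ℂ) → (Fin n → ℂ) → ℂ}
    {F : (Fin n → ℂ) → ℂ} (hF : F ∈ fockOpDomain K) :
    (fun w => F ((c : ℂ) • w)) ∈ fockOpDomain fun z w => K ((c : ℂ) • z) ((c : ℂ) • w) :=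
  ⟨comp_circle_smul_mem_fockSpace c hF.1, fun z =>
    (measurePreserving_circle_smul c).integrable_comp_of_integrable
      (g := fun w => F w * K ((c : ℂ) • z) w) (hF.2 ((c : ℂ) • z))⟩

lemma fockIntegralOp_comp_circle_smul {n : ℕ} (c : Circle) (K : (Fin n → ℂ) → (Fin n → ℂ) → ℂ)
    (F : (Fin n → ℂ) → ℂ) :
    fockIntegralOp (fun z w => K ((c : ℂ) • z) ((c : ℂ) • w)) (fun w => F ((c : ℂ) • w)) =
      fun z => fockIntegralOp K F ((c : ℂ) • z) := by
  ext z
  exact (measurePreserving_circle_smul c).integral_comp (measurableEmbedding_circle_smul c)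
    fun w => F w * K ((c : ℂ) • z) w

lemma circle_smul_inv_smul {n : ℕ} (c : Circle) (w : Fin n → ℂ) :
    (c : ℂ) • ((c⁻¹ : Circle) : ℂ) • w = w := by
  rw [smul_smul, ← Circle.coe_mul, mul_inv_cancel, Circle.coe_one, one_smul]

/-- Boundedness is invariant under a simultaneous rotation of both variables of the kernel. -/
lemma IsBoundedOnFock.comp_circle_smul {n : ℕ} (c : Circle) {K : (Fin n → ℂ) → (Fin n → ℂ) → ℂ}
    (hK : IsBoundedOnFock K) : IsBoundedOnFock fun z w => K ((c : ℂ) • z) ((c : ℂ) • w) := by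
  obtain ⟨C, hC⟩ := hK
  refine ⟨C, fun G hG => ?_⟩
  have hinv : ∀ w : Fin n → ℂ, ((c⁻¹ : Circle) : ℂ) • (c : ℂ) • w = w := fun w => by
    simp [smul_smul]
  have hF := comp_circle_smul_mem_fockOpDomain c⁻¹ hG
  simp only [circle_smul_inv_smul] at hF
  obtain ⟨h1, h2⟩ := hC _ hF
  have h3 := fockIntegralOp_comp_circle_smul c K fun w => G (((c⁻¹ : Circle) : ℂ) • w)
  simp only [hinv] at h3
  rw [h3, eLpNorm_comp_circle_smul c h1]
  refine ⟨comp_circle_smul_mem_fockSpace c h1, ?_⟩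
  rwa [eLpNorm_comp_circle_smul c⁻¹ hG.1] at h2

/-- The imaginary unit as an element of the circle. -/
def circleI : Circle := ⟨Complex.I, by simp [Submonoid.unitSphere]⟩

lemma coe_circleI : (circleI : ℂ) = Complex.I := rfl

/-- The conjugate of iw is -i w̄, so iz plus it is i(z - w̄), while z·w̄ is unchanged. -/
lemma kernelS_comp_I {n : ℕ} (φ : (Fin n → ℂ) → ℂ) :
    kernelS (fun z => φ (Complex.I • z)) =
      fun z w => kernelSTilde φ ((circleI : ℂ) • z) ((circleI : ℂ) • w) := by
  ext z w
  rw [kernelS, kernelSTilde, coe_circleI]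
  congr 2
  · ext j
    simp [conjVec]
    ring
  · congr 1
    refine Finset.sum_congr rfl fun j _ => ?_
    simp only [conjVec, Pi.smul_apply, smul_eq_mul, map_mul, Complex.conj_I]
    linear_combination (z j * conj (w j)) * Complex.I_sq

lemma kernelSTilde_eq {n : ℕ} (φ : (Fin n → ℂ) → ℂ) :
    kernelSTilde φ = fun z w => kernelS (fun z => φ (Complex.I • z))
      (((circleI⁻¹ : Circle) : ℂ) • z) (((circleI⁻¹ : Circle) : ℂ) • w) := by
  rw [kernelS_comp_I]
  simp only [circle_smul_inv_smul]

lemma isBoundedOnFock_kernelSTilde_iff {n : ℕ} (φ : (Fin n → ℂ) → ℂ) :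
    IsBoundedOnFock (kernelSTilde φ) ↔ IsBoundedOnFock (kernelS fun z => φ (Complex.I • z)) := by
  constructor
  · intro h
    rw [kernelS_comp_I]
    exact h.comp_circle_smul _
  · intro h
    rw [kernelSTilde_eq]
    exact h.comp_circle_smul _

lemma shiftSq_I_smul {n : ℕ} (ξ : Fin n → ℝ) (z : Fin n → ℂ) :
    shiftSq (1 / 2) ξ (Complex.I • z) = shiftSq (Complex.I / 2) ξ z := by
  refine Finset.sum_congr rfl fun j _ => ?_
  simp only [Pi.smul_apply, smul_eq_mul]
  ring

lemma forall_comp_I_iff {n : ℕ} (φ : (Fin n → ℂ) → ℂ) (m : (Fin n → ℝ) → ℂ) :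
    (∀ z, φ (Complex.I • z) = ∫ ξ, m ξ * Complex.exp (-shiftSq (Complex.I / 2) ξ z)) ↔
      ∀ z, φ z = ∫ ξ, m ξ * Complex.exp (-shiftSq (1 / 2) ξ z) := by
  simp only [← shiftSq_I_smul]
  refine ⟨fun h z => ?_, fun h z => h _⟩
  have hz := h (-Complex.I • z)
  rwa [smul_smul, mul_neg, Complex.I_mul_I, neg_neg, one_smul] at hz

lemma isBoundedOnFock_kernelS_iff {n : ℕ} {φ : (Fin n → ℂ) → ℂ} (hφ : φ ∈ FockSpace n) :
    IsBoundedOnFock (kernelS φ) ↔ ∃ m : (Fin n → ℝ) → ℂ, MemLp m ∞ volume ∧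
      ∀ z, φ z = ∫ ξ, m ξ * Complex.exp (-shiftSq (Complex.I / 2) ξ z) :=
  ⟨exists_symbol_of_isBoundedOnFock hφ, fun ⟨_, hm, h⟩ => (isBoundedOnFock_of_symbol hm h).1⟩

lemma mem_fockOpDomain_kernelS {n : ℕ} {φ : (Fin n → ℂ) → ℂ} (hφ : φ ∈ FockSpace n)
    (hb : IsBoundedOnFock (kernelS φ)) : ∀ F ∈ FockSpace n, F ∈ fockOpDomain (kernelS φ) := by
  obtain ⟨m, hm, h⟩ := exists_symbol_of_isBoundedOnFock hφ hb
  exact (isBoundedOnFock_of_symbol hm h).2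

end

theorem theorem1p1 (n : ℕ) (φ : (Fin n → ℂ) → ℂ) (hφ : φ ∈ FockSpace n) :
    -- boundedness of `S_φ`
    (IsBoundedOnFock (kernelS φ) ↔
      ∃ m : (Fin n → ℝ) → ℂ, MemLp m ∞ volume ∧
        ∀ z, φ z = ∫ ξ, m ξ * Complex.exp (-shiftSq (Complex.I / 2) ξ z)) ∧
    -- boundedness of `S̃_φ`
    (IsBoundedOnFock (kernelSTilde φ) ↔
      ∃ m : (Fin n → ℝ) → ℂ, MemLp m ∞ volume ∧
        ∀ z, φ z = ∫ ξ, m ξ * Complex.exp (-shiftSq (1 / 2) ξ z)) ∧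
    -- a bounded `S_φ`, resp. `S̃_φ`, is defined on the whole Fock space
    (IsBoundedOnFock (kernelS φ) → ∀ F ∈ FockSpace n, F ∈ fockOpDomain (kernelS φ)) ∧
    (IsBoundedOnFock (kernelSTilde φ) → ∀ F ∈ FockSpace n, F ∈ fockOpDomain (kernelSTilde φ)) ∧
    -- uncertainty principle
    ((¬ ∃ c : ℂ, ∀ z, φ z = c) →
      ¬ IsBoundedOnFock (kernelS φ) ∨ ¬ IsBoundedOnFock (kernelSTilde φ)) := by
  have hφI : (fun z => φ (Complex.I • z)) ∈ FockSpace n :=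
    comp_circle_smul_mem_fockSpace circleI hφ
  refine ⟨isBoundedOnFock_kernelS_iff hφ, ?_, mem_fockOpDomain_kernelS hφ, fun hb F hF => ?_,
    fun hconst => ?_⟩
  · rw [isBoundedOnFock_kernelSTilde_iff, isBoundedOnFock_kernelS_iff hφI]
    simp only [forall_comp_I_iff]
  · rw [isBoundedOnFock_kernelSTilde_iff] at hb
    have h := comp_circle_smul_mem_fockOpDomain circleI⁻¹ (mem_fockOpDomain_kernelS hφI hb _
      (comp_circle_smul_mem_fockSpace circleI hF))
    rw [← kernelSTilde_eq] at h
    simpa only [circle_smul_inv_smul] using h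
  · by_contra! hb
    obtain ⟨hb1, hb2⟩ := hb
    rw [isBoundedOnFock_kernelSTilde_iff] at hb2
    obtain ⟨m₁, hm₁, h₁⟩ := exists_symbol_of_isBoundedOnFock hφ hb1
    obtain ⟨m₂, hm₂, h₂⟩ := exists_symbol_of_isBoundedOnFock hφI hb2
    obtain ⟨C₁, hC₁⟩ := norm_le_of_symbol hm₁ h₁
    obtain ⟨C₂, hC₂⟩ := norm_le_of_symbol hm₂ h₂
    refine hconst ⟨φ 0, apply_eq_apply_zero_of_norm_le_exp hφ.1 (C := max C₁ C₂)
      (fun z => (hC₁ z).trans ?_) fun z => ?_⟩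
    · gcongr
      exact le_max_left _ _
    -- Since Re(-iz) = Im z, the real-part bound for φ(i·) is the imaginary-part bound for φ.
    · have hz := hC₂ (-Complex.I • z)
      rw [smul_smul, mul_neg, Complex.I_mul_I, neg_neg, one_smul] at hz
      refine hz.trans ?_
      simp only [Pi.smul_apply, smul_eq_mul, Complex.mul_re, Complex.neg_re,
        Complex.I_re, Complex.I_im, zero_mul, zero_sub, neg_mul, one_mul, neg_neg]
      gcongr
      exact le_max_right _ _
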